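/- Let $m\ge 1$ and let $(\overline M^{2m+1},\varphi,\xi,\eta,\overline g)$ be a Sasakian space form of constant $\varphi$-sectional curvature $c$, i.e. a Sasakian manifold ($d\eta(X,Y)=\overline g(X,\varphi Y)$, $(\overline\nabla_X\varphi)Y=\overline g(X,Y)\xi-\overline g(Y,\xi)X$) with curvature tensor $\overline R(X,Y)Z=\frac{c+3}{4}\{\overline g(Y,Z)X-\overline g(X,Z)Y\}-\frac{c-1}{4}\{\eta(Z)[\eta(Y)X-\eta(X)Y]+[\overline g(Y,Z)\eta(X)-\overline g(X,Z)\eta(Y)]\xi+\overline g(\varphi X,Z)\varphi Y+2\overline g(\varphi X,Y)\varphi Z-\overline g(\varphi Y,Z)\varphi X\}$. Assume that its Ricci tensor is nondegenerate (equivalently $(m+1)c+3m-1\neq0$), and let $\nabla^\star$, $R^\star$ be the Levi-Civita connection and the curvature tensor of the (possibly indefinite) metric $\mathrm{Ric}$. Let $\psi:M^{2m}\to\overline M^{2m+1}$ be an immersed hypersurface with the metric $g=\psi^*\overline g$, let $N$ be a unit normal, $A$ the Weingarten operator with respect to $N$, $V=-\varphi N$, and let $H=\frac1{2m}(\operatorname{trace}A)\,N$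 be the mean curvature vector field with respect to $\overline g$. Assume that * $M$ is a pseudo-Hopf hypersurface: $\xi$ is tangent to $M$ and $A$ maps $\operatorname{Span}\{\xi,V\}$ into itself; * $M$ is Ricci-biharmonic: $\tau_2^\star(\psi)=-\Delta^\star H-\operatorname{trace}R^\star(d\psi(\cdot),H)d\psi(\cdot)=0$, where $\Delta^\star=-\operatorname{trace}_g(\nabla^\star)^2$ is the rough Laplacian on sections of $\psi^{-1}T\overline M$ (the second covariant derivative being formed with the Levi-Civita connection of $g$ on $M$), and the trace in the curvature term is taken either with respect to $g$ or with respect to $\psi^*\mathrm{Ric}$ (the statement holds for both conventions); * $|H|$ is differentiable and $\operatorname{grad}|H|=\alpha\xi+\beta V$ for functions $\alpha,\beta$ on $M$. Then: 1. If $\alpha=0$ on $M$ and $M$ is connected, then $|H|$ is constant. 2. There is an absolute constant $m_0$ such that, if $m\ge m_0$ and $c>1$, then there is no point of $M$ at which $\alpha\ne0$; that is, no such hypersurface with $\alpha\neq0$ exists. 3. Let $p\in M$ be a point with $\alpha(p)\neq0$ and $H(p)=|H|(p)N(p)$, and let $\gamma_1,\gamma_2$ be the eigenvalues of $A$ at $p$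 on $\operatorname{Span}\{\xi,V\}$: $AW_1=\gamma_1W_1$, $AW_2=\gamma_2W_2$ with $W_1=\cos\theta\,\xi+\sin\theta\,V$, $W_2=-\sin\theta\,\xi+\cos\theta\,V$, $0<\theta<\frac\pi2$. If $\gamma_1+\gamma_2\neq0$, then $c<\frac{1-3m}{1+m}$ or $c>1$, and at $p$, for one of the two signs, $$|H|=\frac12\left(-\frac{-1+m(\gamma_1+\gamma_2)}{m^2}\pm\sqrt{\frac{-\frac{4(-1+c)m^2(1+m)}{-1+c+3m+cm}+\bigl(-1+m(\gamma_1+\gamma_2)\bigr)^2}{m^4}}\right),$$ where the number under the square root is nonnegative. -/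

import Mathlib

open scoped Manifold ContDiff Bundle

noncomputable section

/-- The coordinate space `ℝⁿ`. -/
abbrev Eu (n : ℕ) : Type := EuclideanSpace ℝ (Fin n)

/-! ### Riemannian geometry in coordinates

A field of bilinear forms on (an open subset of) `ℝⁿ` is written `G : Eu n → Eu n → Eu n → Eu n → ℝ`;
`G y v w` is its value at the point `y` on the vectors `v` and `w`. -/

namespace Coord

/-- The `i`-th coordinate vector field `∂ᵢ`. -/
def e {n : ℕ} (i : Fin n) : Eu n := EuclideanSpace.single i 1

/-- The matrix `(b(∂ᵢ, ∂ⱼ))` of a bilinear form. -/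
def gram {n : ℕ} (b : Eu n → Eu n → ℝ) : Matrix (Fin n) (Fin n) ℝ :=
  Matrix.of fun i j => b (e i) (e j)

/-- The trace `∑ bⁱʲ T(∂ᵢ, ∂ⱼ)` of a vector valued bilinear map `T` with respect to the
nondegenerate symmetric bilinear form `b`. -/
def traceWrt {n k : ℕ} (b : Eu n → Eu n → ℝ) (T : Eu n → Eu n → Eu k) : Eu k :=
  ∑ i, ∑ j, (gram b)⁻¹ i j • T (e i) (e j)

/-- Christoffel symbols of the (possibly indefinite) metric `G`: the vector with components
`Γᵏ(v, w) = ∑ₗ gᵏˡ · ½ (∂ᵥ G(w, ∂ₗ) + ∂_w G(v, ∂ₗ) - ∂ₗ G(v, w))`. -/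
def christoffel {n : ℕ} (G : Eu n → Eu n → Eu n → ℝ) (y v w : Eu n) : Eu n :=
  WithLp.toLp 2 fun k => ∑ l, (gram (G y))⁻¹ k l *
    ((1 / 2 : ℝ) * (fderiv ℝ (fun z => G z w (e l)) y v + fderiv ℝ (fun z => G z v (e l)) y w
      - fderiv ℝ (fun z => G z v w) y (e l)))

/-- The covariant derivative `∇_v Y` at `y` of the vector field `Y`, for the Levi-Civita
connection of `G`. -/
def cov {n : ℕ} (G : Eu n → Eu n → Eu n → ℝ) (Y : Eu n → Eu n) (y v : Eu n) : Eu n :=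
  fderiv ℝ Y y v + christoffel G y v (Y y)

/-- The curvature `R(u, v) w = ∇_u ∇_v w - ∇_v ∇_u w` of the Levi-Civita connection of `G`, where
`u`, `v`, `w` are extended as constant (hence commuting) coordinate fields, so that the field
`∇_v w` is `z ↦ Γ_z(v, w)`. -/
def riemann {n : ℕ} (G : Eu n → Eu n → Eu n → ℝ) (y u v w : Eu n) : Eu n :=
  cov G (fun z => christoffel G z v w) y u - cov G (fun z => christoffel G z u w) y v

/-- The Ricci tensor `Ric(v, w) = trace (u ↦ R(u, v) w)`. -/
def ricci {n : ℕ} (G : Eu n → Eu n → Eu n → ℝ) (y v w : Eu n) : ℝ :=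
  ∑ i, riemann G y (e i) v w i

/-- The pull-back `f^* G`. -/
def induced {k n : ℕ} (G : Eu n → Eu n → Eu n → ℝ) (f : Eu k → Eu n) (u v w : Eu k) : ℝ :=
  G (f u) (fderiv ℝ f u v) (fderiv ℝ f u w)

/-- The covariant derivative `∇_v Z` at `u` of a vector field `Z` along the map `f`, for the
pull-back by `f` of the Levi-Civita connection of `G`. -/
def covAlong {k n : ℕ} (G : Eu n → Eu n → Eu n → ℝ) (f : Eu k → Eu n) (Z : Eu k → Eu n)
    (u v : Eu k) : Eu n :=
  fderiv ℝ Z u v + christoffel G (f u) (fderiv ℝ f u v) (Z u)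

/-- The second covariant derivative `∇²_{v, w} Z = ∇_v (∇_w Z) - ∇_{D_v w} Z` of a vector field
along `f`; `∇` is the pull-back of the Levi-Civita connection of `G` and `D` is the Levi-Civita
connection of the metric `h` on the source. -/
def secondCov {k n : ℕ} (h : Eu k → Eu k → Eu k → ℝ) (G : Eu n → Eu n → Eu n → ℝ)
    (f : Eu k → Eu n) (Z : Eu k → Eu n) (u v w : Eu k) : Eu n :=
  covAlong G f (fun t => covAlong G f Z t w) u v - covAlong G f Z u (christoffel h u v w)

/-- The bitension field `τ₂* = -Δ* H - trace R*(df ·, H) df ·` of the immersion `f` into a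
space with metric `G`. Here `∇*` and `R*` are the Levi-Civita connection and the curvature of the
Ricci tensor of `G`, `Δ* = - trace (∇*)²` is the rough Laplacian on fields along `f` for
the induced metric `f^* G`, and `b` is the metric used to contract the curvature term. -/
def bitension {k n : ℕ} (G : Eu n → Eu n → Eu n → ℝ) (f : Eu k → Eu n) (H : Eu k → Eu n)
    (b : Eu k → Eu k → Eu k → ℝ) (u : Eu k) : Eu n :=
  traceWrt (induced G f u) (secondCov (induced G f) (ricci G) f H u)
    - traceWrt (b u) fun v w =>
        riemann (ricci G) (f u) (fderiv ℝ f u v) (H u) (fderiv ℝ f u w)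

end Coord

/-! ### Coordinate expressions on a manifold -/

section Charts

variable {n k : ℕ} {P : Type*} [TopologicalSpace P] [ChartedSpace (Eu n) P]
  {M : Type*} [TopologicalSpace M] [ChartedSpace (Eu k) M]

/-- The components in the chart `c` of a tangent vector at `x`. -/
def toCoord (c : OpenPartialHomeomorph P (Eu n)) (x : P) (v : TangentSpace (𝓡 n) x) : Eu n :=
  mfderiv (𝓡 n) (𝓡 n) c x v

/-- The tangent vector at `c.symm y` with components `v` in the chart `c`. -/
def ofCoord (c : OpenPartialHomeomorph P (Eu n)) (y v : Eu n) : TangentSpace (𝓡 n) (c.symm y) :=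
  mfderiv (𝓡 n) (𝓡 n) c.symm y v

/-- Coordinate expression of a map in the charts `c` and `d`. -/
def mapIn (c : OpenPartialHomeomorph M (Eu k)) (d : OpenPartialHomeomorph P (Eu n))
    (ψ : M → P) (u : Eu k) : Eu n :=
  d (ψ (c.symm u))

/-- The open set on which the coordinate expression of `ψ` in the charts `c`, `d` lives. -/
def domIn (c : OpenPartialHomeomorph M (Eu k)) (d : OpenPartialHomeomorph P (Eu n))
    (ψ : M → P) : Set (Eu k) :=
  {u | u ∈ c.target ∧ ψ (c.symm u) ∈ d.source}

/-- Coordinate expression of a vector field along `ψ`. -/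
def alongIn (c : OpenPartialHomeomorph M (Eu k)) (d : OpenPartialHomeomorph P (Eu n))
    (ψ : M → P) (Z : ∀ p : M, TangentSpace (𝓡 n) (ψ p)) (u : Eu k) : Eu n :=
  toCoord d (ψ (c.symm u)) (Z (c.symm u))

/-- Coordinate expression of a field of endomorphisms. -/
def endoIn (c : OpenPartialHomeomorph P (Eu n))
    (F : ∀ x : P, TangentSpace (𝓡 n) x →L[ℝ] TangentSpace (𝓡 n) x) (y v : Eu n) : Eu n :=
  toCoord c (c.symm y) (F (c.symm y) (ofCoord c y v))

end Charts

/-! ### Sasakian space forms -/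

/-- A Riemannian metric `g`, a `(1,1)`-tensor field `φ`, a vector field `ξ` and a one-form `η` on an
`n`-dimensional manifold, all smooth (for `η`, smoothness follows from `η = g(ξ, ·)` below). -/
structure ContactData (n : ℕ) (P : Type*) [TopologicalSpace P] [ChartedSpace (Eu n) P]
    [IsManifold (𝓡 n) ∞ P] where
  g : Bundle.ContMDiffRiemannianMetric (𝓡 n) ∞ (Eu n) (fun x : P => TangentSpace (𝓡 n) x)
  φ : ∀ x : P, TangentSpace (𝓡 n) x →L[ℝ] TangentSpace (𝓡 n) x
  ξ : ∀ x : P, TangentSpace (𝓡 n) x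
  η : ∀ x : P, TangentSpace (𝓡 n) x →L[ℝ] ℝ
  smooth_φ : ContMDiff (𝓡 n) ((𝓡 n).prod 𝓘(ℝ, Eu n →L[ℝ] Eu n)) ∞
    (fun x => Bundle.TotalSpace.mk' (Eu n →L[ℝ] Eu n)
      (E := fun x : P => TangentSpace (𝓡 n) x →L[ℝ] TangentSpace (𝓡 n) x) x (φ x))
  smooth_ξ : ContMDiff (𝓡 n) ((𝓡 n).prod 𝓘(ℝ, Eu n)) ∞
    (fun x => Bundle.TotalSpace.mk' (Eu n) (E := fun x : P => TangentSpace (𝓡 n) x) x (ξ x))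

namespace ContactData

variable {n : ℕ} {P : Type*} [TopologicalSpace P] [ChartedSpace (Eu n) P]
  [IsManifold (𝓡 n) ∞ P] (S : ContactData n P)

/-- Coordinate expression of the metric. -/
def gIn (c : OpenPartialHomeomorph P (Eu n)) (y v w : Eu n) : ℝ :=
  S.g.inner (c.symm y) (ofCoord c y v) (ofCoord c y w)

/-- Coordinate expression of the one-form `η`. -/
def ηIn (c : OpenPartialHomeomorph P (Eu n)) (y v : Eu n) : ℝ :=
  S.η (c.symm y) (ofCoord c y v)

/-- Coordinate expression of the vector field `ξ`. -/
def ξIn (c : OpenPartialHomeomorph P (Eu n)) (y : Eu n) : Eu n :=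
  toCoord c (c.symm y) (S.ξ (c.symm y))

/-- `(φ, ξ, η, g)` is an almost contact metric structure. -/
structure IsAlmostContactMetric : Prop where
  φ_sq : ∀ x v, S.φ x (S.φ x v) = -v + S.η x v • S.ξ x
  η_ξ : ∀ x, S.η x (S.ξ x) = 1
  φ_ξ : ∀ x, S.φ x (S.ξ x) = 0
  η_eq : ∀ x v, S.η x v = S.g.inner x (S.ξ x) v
  g_φ : ∀ x v w, S.g.inner x (S.φ x v) (S.φ x w) = S.g.inner x v w - S.η x v * S.η x w

/-- `(φ, ξ, η, g)` is a Sasakian structure: an almost contact metric structure with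
`dη(X, Y) = g(X, φ Y)`, where `2 dη(X, Y) = X η(Y) - Y η(X) - η([X, Y])`, and
`(∇_X φ) Y = g(X, Y) ξ - g(Y, ξ) X`. The last two identities are written in the charts of
the atlas, with `X = v` and `Y = w` coordinate fields. -/
structure IsSasakian : Prop extends S.IsAlmostContactMetric where
  contact : ∀ c ∈ atlas (Eu n) P, ∀ y ∈ c.target, ∀ v w : Eu n,
    (1 / 2 : ℝ) * (fderiv ℝ (fun z => S.ηIn c z w) y v - fderiv ℝ (fun z => S.ηIn c z v) y w)
      = S.gIn c y v (endoIn c S.φ y w)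
  cov_φ : ∀ c ∈ atlas (Eu n) P, ∀ y ∈ c.target, ∀ v w : Eu n,
    Coord.cov (S.gIn c) (fun z => endoIn c S.φ z w) y v
        - endoIn c S.φ y (Coord.christoffel (S.gIn c) y v w)
      = S.gIn c y v w • S.ξIn c y - S.gIn c y w (S.ξIn c y) • v

/-- A Sasakian space form: a Sasakian manifold of constant `φ`-sectional curvature `c`, i.e. with
the curvature tensor
`R(X,Y)Z = -(c-1)/4 {η(Z)[η(Y)X - η(X)Y] + [g(Y,Z)η(X) - g(X,Z)η(Y)]ξ
  + g(φX,Z)φY + 2g(φX,Y)φZ - g(φY,Z)φX} + (c+3)/4 {g(Y,Z)X - g(X,Z)Y}`. -/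
structure IsSasakianSpaceForm (c : ℝ) : Prop extends S.IsSasakian where
  curvature : ∀ d ∈ atlas (Eu n) P, ∀ y ∈ d.target, ∀ X Y Z : Eu n,
    Coord.riemann (S.gIn d) y X Y Z =
      (-((c - 1) / 4)) •
        (S.ηIn d y Z • (S.ηIn d y Y • X - S.ηIn d y X • Y)
          + (S.gIn d y Y Z * S.ηIn d y X - S.gIn d y X Z * S.ηIn d y Y) • S.ξIn d y
          + S.gIn d y (endoIn d S.φ y X) Z • endoIn d S.φ y Y
          + (2 * S.gIn d y (endoIn d S.φ y X) Y) • endoIn d S.φ y Z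
          - S.gIn d y (endoIn d S.φ y Y) Z • endoIn d S.φ y X)
      + ((c + 3) / 4) • (S.gIn d y Y Z • X - S.gIn d y X Z • Y)

/-- The Ricci tensor is nondegenerate at every point, so that it is a (possibly indefinite)
metric with a Levi-Civita connection. -/
def RicciNondegenerate : Prop :=
  ∀ c ∈ atlas (Eu n) P, ∀ y ∈ c.target, ∀ v : Eu n, v ≠ 0 →
    ∃ w : Eu n, Coord.ricci (S.gIn c) y v w ≠ 0

end ContactData

/-! ### Hypersurfaces -/

section Hypersurface

variable {k n : ℕ} {P : Type*} [TopologicalSpace P] [ChartedSpace (Eu n) P]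
  [IsManifold (𝓡 n) ∞ P] (S : ContactData n P)
  {M : Type*} [TopologicalSpace M] [ChartedSpace (Eu k) M]

/-- A smooth immersion. -/
def IsSmoothImmersion (ψ : M → P) : Prop :=
  ContMDiff (𝓡 k) (𝓡 n) ∞ ψ ∧ ∀ p, Function.Injective (mfderiv (𝓡 k) (𝓡 n) ψ p)

variable (ψ : M → P)

/-- `N` is a unit vector normal to the hypersurface at each point. No continuity in the point is
required: locally `N` is, up to a sign at each point, a smooth unit normal field. -/
def IsUnitNormal (N : ∀ p : M, TangentSpace (𝓡 n) (ψ p)) : Prop :=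
  ∀ p, S.g.inner (ψ p) (N p) (N p) = 1 ∧
    ∀ v, S.g.inner (ψ p) (N p) (mfderiv (𝓡 k) (𝓡 n) ψ p v) = 0

/-- `A` is the Weingarten (shape) operator of the hypersurface for the unit normal `N`:
`g(A X, Y) = g(B(X, Y), N) = g(∇_X Y, N)` for `X`, `Y` tangent to `M`, where `g` on `M` is the
induced metric and `∇` the Levi-Civita connection of the ambient manifold. (`X = v` and `Y = w`
are taken to be coordinate fields of charts of `M`.) -/
def IsShapeOperator (N : ∀ p : M, TangentSpace (𝓡 n) (ψ p))
    (A : ∀ p : M, TangentSpace (𝓡 k) p →L[ℝ] TangentSpace (𝓡 k) p) : Prop :=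
  ∀ c ∈ atlas (Eu k) M, ∀ d ∈ atlas (Eu n) P, ∀ u ∈ domIn c d ψ, ∀ v w : Eu k,
    Coord.induced (S.gIn d) (mapIn c d ψ) u (endoIn c A u v) w
      = S.gIn d (mapIn c d ψ u)
          (Coord.covAlong (S.gIn d) (mapIn c d ψ) (fun t => fderiv ℝ (mapIn c d ψ) t w) u v)
          (alongIn c d ψ N u)

/-- The vector field `V = -φ N` along the hypersurface. -/
def structV (N : ∀ p : M, TangentSpace (𝓡 n) (ψ p)) (p : M) : TangentSpace (𝓡 n) (ψ p) :=
  -S.φ (ψ p) (N p)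

/-- Pseudo-Hopf hypersurface: `ξ` is tangent to `M` and the shape operator maps
`D^⊥ = Span{ξ, V}` into itself. -/
def IsPseudoHopf (N : ∀ p : M, TangentSpace (𝓡 n) (ψ p))
    (A : ∀ p : M, TangentSpace (𝓡 k) p →L[ℝ] TangentSpace (𝓡 k) p) : Prop :=
  (∀ p : M, ∃ v : TangentSpace (𝓡 k) p, mfderiv (𝓡 k) (𝓡 n) ψ p v = S.ξ (ψ p)) ∧
  ∀ (p : M) (X : TangentSpace (𝓡 k) p),
    mfderiv (𝓡 k) (𝓡 n) ψ p X ∈ Submodule.span ℝ {S.ξ (ψ p), structV S ψ N p} →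
    mfderiv (𝓡 k) (𝓡 n) ψ p (A p X) ∈ Submodule.span ℝ {S.ξ (ψ p), structV S ψ N p}

/-- The mean curvature vector field `H = (1 / k) trace B = (1 / k) (trace A) N`, `k = dim M`. -/
def meanCurv (N : ∀ p : M, TangentSpace (𝓡 n) (ψ p))
    (A : ∀ p : M, TangentSpace (𝓡 k) p →L[ℝ] TangentSpace (𝓡 k) p) (p : M) :
    TangentSpace (𝓡 n) (ψ p) :=
  ((1 / (k : ℝ)) * LinearMap.trace ℝ (TangentSpace (𝓡 k) p) (A p).toLinearMap) • N p

/-- The mean curvature `|H| = √ g(H, H)`. -/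
def normH (N : ∀ p : M, TangentSpace (𝓡 n) (ψ p))
    (A : ∀ p : M, TangentSpace (𝓡 k) p →L[ℝ] TangentSpace (𝓡 k) p) (p : M) : ℝ :=
  √(S.g.inner (ψ p) (meanCurv ψ N A p) (meanCurv ψ N A p))

/-- `|H|` is differentiable on `M` and `grad |H| = Z`, for a field `Z` of vectors tangent
to `M` (seen as vectors of the ambient manifold): `d|H|(X) = g(Z, X)`. -/
def IsGradNormH (N : ∀ p : M, TangentSpace (𝓡 n) (ψ p))
    (A : ∀ p : M, TangentSpace (𝓡 k) p →L[ℝ] TangentSpace (𝓡 k) p)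
    (Z : ∀ p : M, TangentSpace (𝓡 n) (ψ p)) : Prop :=
  ∀ p, MDifferentiableAt (𝓡 k) 𝓘(ℝ, ℝ) (normH S ψ N A) p ∧
    ∀ v : TangentSpace (𝓡 k) p, mfderiv (𝓡 k) 𝓘(ℝ, ℝ) (normH S ψ N A) p v
      = S.g.inner (ψ p) (Z p) (mfderiv (𝓡 k) (𝓡 n) ψ p v)

/-- Ricci-biharmonic hypersurface: the bitension field `τ₂*` of the connection of the
metric `Ric` vanishes. The curvature term may be contracted with the induced metric `ψ^* g`
(first case) or with the pull-back `ψ^* Ric` (second case); both conventions are covered. -/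
def IsRicciBiharmonic (N : ∀ p : M, TangentSpace (𝓡 n) (ψ p))
    (A : ∀ p : M, TangentSpace (𝓡 k) p →L[ℝ] TangentSpace (𝓡 k) p) : Prop :=
  (∀ c ∈ atlas (Eu k) M, ∀ d ∈ atlas (Eu n) P, ∀ u ∈ domIn c d ψ,
    Coord.bitension (S.gIn d) (mapIn c d ψ) (alongIn c d ψ (meanCurv ψ N A))
      (Coord.induced (S.gIn d) (mapIn c d ψ)) u = 0) ∨
  (∀ c ∈ atlas (Eu k) M, ∀ d ∈ atlas (Eu n) P, ∀ u ∈ domIn c d ψ,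
    Coord.bitension (S.gIn d) (mapIn c d ψ) (alongIn c d ψ (meanCurv ψ N A))
      (Coord.induced (Coord.ricci (S.gIn d)) (mapIn c d ψ)) u = 0)

end Hypersurface

end

noncomputable section

set_option synthInstance.maxHeartbeats 200000

/-! ### Levi-Civita connections in coordinates. -/

namespace Coord

variable {n k : ℕ}

/-! The two gradient coefficients vanish identically: `α = 0` and `β = 0` at every point. Hence
`|H|` has zero differential and is constant on a connected `M`, while the claims about points with
`α ≠ 0` are vacuous, with `m₀ = 0`. The two vanishings have independent causes.

`α = 0`: on a Sasakian manifold `∇_v ξ = -φ v` with `φ` skew, so `ξ` is Killing. As `ξ` is tangent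
to `M`, its flow preserves the induced metric and, up to sign conventions, the second fundamental
form; the trace of the shape operator is therefore constant along `ξ`. Infinitesimally, the Lie
derivatives of both forms along `ξ` vanish (`fderiv_inner_fderiv`, `fderiv_inner_covField_ν`),
whence `fderiv_traceNu_w`. Biharmonicity plays no role here.

`β = 0`: this is the `ξ`-component of the biharmonic equation. The Ricci tensor of a space form is
`a g + b η ⊗ η`, and its Levi-Civita connection is `∇* = ∇ - κ (η ⊗ φ + φ ⊗ η)` with `κ = b / a`
(`exists_ricci_connection`). Since `η ∘ φ = 0`, the deformation is invisible in `η(∇*_v Z) = v(η Z)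
+ g(Z, φ v)`. Using this identity twice gives two facts.

Firstly, `η(R*(u, v) w) = (1 + κ)(η(u) g(v, w) - η(v) g(u, w))`, which is zero for `u`, `w` tangent
and `v = H`, because `H` is normal and `η(H) = 0`. The curvature term thus drops out before any
contraction, so the metric used for that contraction does not matter.

Secondly, for `H = h ν`, the `ξ`-component of the second covariant derivative at `(v, x)` is `g(∇_v
H, φ x) + g(∇_x H, φ v)`. In its trace the shape operator is paired with the skew form `g(·, φ ·)`
and contributes nothing; what remains is `2 V(h)` (`η_trace_secondCov`). The equation therefore
forces `V(h) = 0`.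

All this is local: `N` may be discontinuous, but near each point it is `± ν` with `ν` smooth, and
`|H| = |h|` with `h` smooth. The local result is `exists_meanCurvature`; `grad_normH_eq_zero`
carries it to the manifold. -/

lemma eq_sum_smul_e (v : Eu n) : v = ∑ i, v i • (e i : Eu n) := by
  have := ((EuclideanSpace.basisFun (Fin n) ℝ).sum_repr v).symm
  simpa [e] using this

lemma clm_apply_eq_sum {F : Type*} [NormedAddCommGroup F] [NormedSpace ℝ F]
    (L : Eu n →L[ℝ] F) (v : Eu n) : L v = ∑ i, v i • L (e i) := by
  conv_lhs => rw [eq_sum_smul_e v]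
  simp

lemma e_apply (i j : Fin n) : (e i : Eu n) j = if j = i then 1 else 0 := by
  simp [e]

/-- The Gram matrix of a nondegenerate bilinear form is invertible. -/
lemma isUnit_det_gram (b : Eu n →L[ℝ] Eu n →L[ℝ] ℝ) (hb : ∀ v, v ≠ 0 → ∃ w, b v w ≠ 0) :
    IsUnit (gram fun v w => b v w).det := by
  rw [isUnit_iff_ne_zero]
  intro h
  obtain ⟨v, hv, h0⟩ := Matrix.exists_vecMul_eq_zero_iff.2 h
  obtain ⟨w, hw⟩ := hb (WithLp.toLp 2 v) (by simpa using hv)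
  apply hw
  rw [clm_apply_eq_sum (b _) w]
  refine Finset.sum_eq_zero fun j _ => ?_
  have hj := congrFun h0 j
  have : b (WithLp.toLp 2 v) (e j) = 0 := by
    have := congrArg (fun L : Eu n →L[ℝ] ℝ => L (e j)) (clm_apply_eq_sum b (WithLp.toLp 2 v))
    rw [this]
    simpa [Matrix.vecMul, dotProduct, gram, _root_.sum_apply] using hj
  rw [this, smul_zero]

lemma isUnit_det_gram_of_pos (b : Eu n →L[ℝ] Eu n →L[ℝ] ℝ) (hb : ∀ v, v ≠ 0 → 0 < b v v) :
    IsUnit (gram fun v w => b v w).det :=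
  isUnit_det_gram b fun v hv => ⟨v, (hb v hv).ne'⟩

lemma gram_transpose (b : Eu n → Eu n → ℝ) (hs : ∀ v w, b v w = b w v) :
    (gram b).transpose = gram b := by
  ext i j; simp [gram, hs (e i)]

lemma gram_inv_symm (b : Eu n → Eu n → ℝ) (hs : ∀ v w, b v w = b w v) (i j : Fin n) :
    (gram b)⁻¹ i j = (gram b)⁻¹ j i := by
  have := Matrix.transpose_nonsing_inv (gram b)
  rw [gram_transpose b hs] at this
  exact (congrFun (congrFun this j) i)

/-- The vector whose scalar products with the coordinate fields are prescribed. -/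
lemma inner_toLp_gram_inv (b : Eu n →L[ℝ] Eu n →L[ℝ] ℝ) (hs : ∀ v w, b v w = b w v)
    (hu : IsUnit (gram fun v w => b v w).det) (K : Eu n →L[ℝ] ℝ) (x : Eu n) :
    b (WithLp.toLp 2 fun i => ∑ l, (gram fun v w => b v w)⁻¹ i l * K (e l)) x = K x := by
  rw [clm_apply_eq_sum (b _) x, clm_apply_eq_sum K x]
  refine Finset.sum_congr rfl fun j _ => ?_
  congr 1
  have := congrArg (fun L : Eu n →L[ℝ] ℝ => L (e j)) (clm_apply_eq_sum b
    (WithLp.toLp 2 fun i => ∑ l, (gram fun v w => b v w)⁻¹ i l * K (e l)))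
  rw [this]
  have h1 := Matrix.mul_nonsing_inv _ hu
  have h2 : ∀ l, ∑ i, b (e j) (e i) * (gram fun v w => b v w)⁻¹ i l = if j = l then 1 else 0 := by
    intro l
    simpa [Matrix.mul_apply, gram, Matrix.one_apply] using congrFun (congrFun h1 j) l
  calc _ = ∑ i, ∑ l, (b (e j) (e i) * (gram fun v w => b v w)⁻¹ i l) * K (e l) := by
        simp only [_root_.sum_apply, _root_.smul_apply, smul_eq_mul,
          Finset.sum_mul]
        refine Finset.sum_congr rfl fun i _ => Finset.sum_congr rfl fun l _ => ?_
        rw [hs (e i)]; ring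
    _ = K (e j) := by
        rw [Finset.sum_comm]
        simp only [← Finset.sum_mul, h2]
        simp

lemma eq_of_inner_eq (b : Eu n →L[ℝ] Eu n →L[ℝ] ℝ)
    (hu : IsUnit (gram fun v w => b v w).det) {x y : Eu n} (h : ∀ i, b x (e i) = b y (e i)) :
    x = y := by
  have h0 : Matrix.vecMul (x - y).ofLp (gram fun v w => b v w) = 0 := by
    ext j
    have := congrArg (fun L : Eu n →L[ℝ] ℝ => L (e j)) (clm_apply_eq_sum b (x - y))
    have h' : b (x - y) (e j) = 0 := by simp [h j]
    rw [h'] at this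
    simpa [Matrix.vecMul, dotProduct, gram, _root_.sum_apply] using this.symm
  have := Matrix.eq_zero_of_vecMul_eq_zero (hu.ne_zero) h0
  have h2 : x - y = 0 := by ext i; exact congrFun this i
  exact sub_eq_zero.1 h2

/-- The covector `½ (∂ᵥ g(w, ·) + ∂_w g(v, ·) - ∂_· g(v, w))`. -/
def koszul (g : Eu n → Eu n →L[ℝ] Eu n →L[ℝ] ℝ) (y v w : Eu n) : Eu n →L[ℝ] ℝ :=
  (1 / 2 : ℝ) • (fderiv ℝ g y v w + fderiv ℝ g y w v - ((fderiv ℝ g y).flip v).flip w)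

lemma koszul_apply (g : Eu n → Eu n →L[ℝ] Eu n →L[ℝ] ℝ) (y v w x : Eu n) :
    koszul g y v w x
      = 1 / 2 * (fderiv ℝ g y v w x + fderiv ℝ g y w v x - fderiv ℝ g y x v w) := by
  simp [koszul]

lemma fderiv_bilin {E : Type*} [NormedAddCommGroup E] [NormedSpace ℝ E]
    {F : Type*} [NormedAddCommGroup F] [NormedSpace ℝ F]
    {g : E → Eu n →L[ℝ] Eu n →L[ℝ] F} {y : E}
    (hg : DifferentiableAt ℝ g y) (v w : Eu n) (u : E) :
    fderiv ℝ (fun z => g z v w) y u = fderiv ℝ g y u v w := by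
  have h1 : HasFDerivAt (fun z => g z v) _ y := hg.hasFDerivAt.clm_apply (hasFDerivAt_const v y)
  have h2 : HasFDerivAt (fun z => g z v w) _ y := h1.clm_apply (hasFDerivAt_const w y)
  rw [h2.fderiv]
  simp

lemma christoffel_eq (g : Eu n → Eu n →L[ℝ] Eu n →L[ℝ] ℝ) {y : Eu n}
    (hg : DifferentiableAt ℝ g y) (v w : Eu n) :
    christoffel (fun z a b => g z a b) y v w
      = WithLp.toLp 2 fun i => ∑ l, (gram fun a b => g y a b)⁻¹ i l *
          koszul g y v w (e l) := by
  simp only [christoffel, fderiv_bilin hg, koszul_apply]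

lemma inner_christoffel {g : Eu n → Eu n →L[ℝ] Eu n →L[ℝ] ℝ} {y : Eu n}
    (hg : DifferentiableAt ℝ g y) (hs : ∀ v w, g y v w = g y w v)
    (hu : IsUnit (gram fun v w => g y v w).det) (v w x : Eu n) :
    g y (christoffel (fun z a b => g z a b) y v w) x = koszul g y v w x := by
  rw [christoffel_eq g hg]
  exact inner_toLp_gram_inv (g y) hs hu _ x

/-- Nondegeneracy makes the Koszul formula characterize the Levi-Civita connection. This is the tool
for recognizing the connection of the Ricci tensor from a proposed closed form. -/
lemma christoffel_eq_of_inner {g : Eu n → Eu n →L[ℝ] Eu n →L[ℝ] ℝ} {y : Eu n}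
    (hg : DifferentiableAt ℝ g y) (hs : ∀ v w, g y v w = g y w v)
    (hu : IsUnit (gram fun v w => g y v w).det) {v w x : Eu n}
    (h : ∀ z, g y x z = koszul g y v w z) :
    christoffel (fun z a b => g z a b) y v w = x :=
  eq_of_inner_eq (g y) hu fun i => by rw [inner_christoffel hg hs hu, h]

lemma contDiffOn_det {E : Type*} [NormedAddCommGroup E] [NormedSpace ℝ E] {s : Set E}
    {r : ℕ∞ω} {M : E → Matrix (Fin n) (Fin n) ℝ} (hM : ∀ i j, ContDiffOn ℝ r (fun z => M z i j) s) :
    ContDiffOn ℝ r (fun z => (M z).det) s := by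
  simp only [Matrix.det_apply]
  refine ContDiffOn.sum fun σ _ => ContDiffOn.const_smul _ ?_
  exact contDiffOn_prod fun i _ => hM _ _

/-- By Cramer's rule the entries of the inverse are determinants divided by a nonvanishing
determinant. -/
lemma contDiffOn_matrix_inv {E : Type*} [NormedAddCommGroup E] [NormedSpace ℝ E] {s : Set E}
    {r : ℕ∞ω} {M : E → Matrix (Fin n) (Fin n) ℝ} (hM : ∀ i j, ContDiffOn ℝ r (fun z => M z i j) s)
    (hu : ∀ z ∈ s, IsUnit (M z).det) (i j : Fin n) :
    ContDiffOn ℝ r (fun z => (M z)⁻¹ i j) s := by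
  simp only [Matrix.inv_def, Matrix.smul_apply, smul_eq_mul, Ring.inverse_eq_inv',
    Matrix.adjugate_apply]
  refine ((contDiffOn_det hM).inv fun z hz => (hu z hz).ne_zero).mul (contDiffOn_det ?_)
  intro a b
  by_cases h : a = j
  · subst h; simpa using contDiffOn_const
  · simpa [Matrix.updateRow_ne h] using hM a b

lemma koszul_add_left (g : Eu n → Eu n →L[ℝ] Eu n →L[ℝ] ℝ) (y v v' w x : Eu n) :
    koszul g y (v + v') w x = koszul g y v w x + koszul g y v' w x := by
  rw [koszul_apply, koszul_apply, koszul_apply, ContinuousLinearMap.map_add,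
    (fderiv ℝ g y w).map_add, (fderiv ℝ g y x).map_add]
  simp only [_root_.add_apply]; ring

lemma koszul_smul_left (g : Eu n → Eu n →L[ℝ] Eu n →L[ℝ] ℝ) (y v w x : Eu n) (r : ℝ) :
    koszul g y (r • v) w x = r * koszul g y v w x := by
  rw [koszul_apply, koszul_apply, ContinuousLinearMap.map_smul,
    (fderiv ℝ g y w).map_smul, (fderiv ℝ g y x).map_smul]
  simp only [_root_.smul_apply, smul_eq_mul]; ring

lemma koszul_add_right (g : Eu n → Eu n →L[ℝ] Eu n →L[ℝ] ℝ) (y v w w' x : Eu n) :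
    koszul g y v (w + w') x = koszul g y v w x + koszul g y v w' x := by
  rw [koszul_apply, koszul_apply, koszul_apply, (fderiv ℝ g y).map_add w w',
    (fderiv ℝ g y v).map_add, (fderiv ℝ g y x v).map_add]
  simp only [_root_.add_apply]; ring

lemma koszul_smul_right (g : Eu n → Eu n →L[ℝ] Eu n →L[ℝ] ℝ) (y v w x : Eu n) (r : ℝ) :
    koszul g y v (r • w) x = r * koszul g y v w x := by
  rw [koszul_apply, koszul_apply, (fderiv ℝ g y).map_smul r w,
    (fderiv ℝ g y v).map_smul, (fderiv ℝ g y x v).map_smul]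
  simp only [_root_.smul_apply, smul_eq_mul]; ring

lemma contDiffOn_fderiv_metric {g : Eu n → Eu n →L[ℝ] Eu n →L[ℝ] ℝ} {U : Set (Eu n)}
    (hU : IsOpen U) (hg : ContDiffOn ℝ ∞ g U) (a b c : Eu n) :
    ContDiffOn ℝ ∞ (fun y => fderiv ℝ g y a b c) U := by
  have h1 : ContDiffOn ℝ ∞ (fun z => g z b c) U :=
    (hg.clm_apply contDiffOn_const).clm_apply contDiffOn_const
  have h2 : ContDiffOn ℝ ∞ (fun y => fderiv ℝ (fun z => g z b c) y a) U :=
    (h1.fderiv_of_isOpen hU (by simp)).clm_apply contDiffOn_const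
  refine h2.congr fun y hy => ?_
  rw [fderiv_bilin ((hg.contDiffAt (hU.mem_nhds hy)).differentiableAt (by simp))]

/-- The bilinear map whose value is given by the Koszul formula. -/
def koszulMap (g : Eu n → Eu n →L[ℝ] Eu n →L[ℝ] ℝ) (y : Eu n) : Eu n →ₗ[ℝ] Eu n →ₗ[ℝ] Eu n :=
  LinearMap.mk₂ ℝ (fun v w => WithLp.toLp 2 fun i => ∑ l, (gram fun a b => g y a b)⁻¹ i l *
        koszul g y v w (e l))
    (fun a b c => by
      ext i; simp only [koszul_add_left, PiLp.add_apply, mul_add, Finset.sum_add_distrib])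
    (fun a b c => by
      ext i; simp only [koszul_smul_left, PiLp.smul_apply, smul_eq_mul, Finset.mul_sum]
      exact Finset.sum_congr rfl fun l _ => by ring)
    (fun a b c => by
      ext i; simp only [koszul_add_right, PiLp.add_apply, mul_add, Finset.sum_add_distrib])
    (fun a b c => by
      ext i; simp only [koszul_smul_right, PiLp.smul_apply, smul_eq_mul, Finset.mul_sum]
      exact Finset.sum_congr rfl fun l _ => by ring)

/-- A bilinear map on a coordinate space as a continuous bilinear map. -/
def toContinuousBilin {F : Type*} [NormedAddCommGroup F] [NormedSpace ℝ F]
    (B : Eu n →ₗ[ℝ] Eu n →ₗ[ℝ] F) : Eu n →L[ℝ] Eu n →L[ℝ] F :=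
  LinearMap.toContinuousLinearMap
    ((LinearMap.toContinuousLinearMap (𝕜 := ℝ) (E := Eu n) (F' := F)).toLinearMap ∘ₗ B)

lemma toContinuousBilin_apply {F : Type*} [NormedAddCommGroup F] [NormedSpace ℝ F]
    (B : Eu n →ₗ[ℝ] Eu n →ₗ[ℝ] F) (v w : Eu n) : toContinuousBilin B v w = B v w := rfl

lemma contDiffOn_clm_apply_iff₂ {E F : Type*} [NormedAddCommGroup E] [NormedSpace ℝ E]
    [NormedAddCommGroup F] [NormedSpace ℝ F]
    {B : E → Eu n →L[ℝ] Eu n →L[ℝ] F} {U : Set E} :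
    ContDiffOn ℝ ∞ B U ↔ ∀ v w, ContDiffOn ℝ ∞ (fun y => B y v w) U := by
  rw [contDiffOn_clm_apply]
  exact forall_congr' fun v => contDiffOn_clm_apply

/-- The Christoffel symbols of a smooth nondegenerate metric form a smooth field of
bilinear maps. -/
lemma exists_christoffel {g : Eu n → Eu n →L[ℝ] Eu n →L[ℝ] ℝ} {U : Set (Eu n)} (hU : IsOpen U)
    (hg : ContDiffOn ℝ ∞ g U) (hu : ∀ y ∈ U, IsUnit (gram fun v w => g y v w).det) :
    ∃ Γ : Eu n → Eu n →L[ℝ] Eu n →L[ℝ] Eu n, ContDiffOn ℝ ∞ Γ U ∧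
      ∀ y ∈ U, ∀ v w, christoffel (fun z a b => g z a b) y v w = Γ y v w := by
  refine ⟨fun y => toContinuousBilin (koszulMap g y), ?_, fun y hy v w => ?_⟩
  · rw [contDiffOn_clm_apply_iff₂]
    intro v w
    rw [contDiffOn_piLp]; intro i
    simp only [toContinuousBilin_apply, koszulMap, LinearMap.mk₂_apply, koszul_apply]
    refine ContDiffOn.sum fun l _ => ContDiffOn.mul ?_ ?_
    · refine contDiffOn_matrix_inv ?_ hu i l
      intro a b
      exact (hg.clm_apply contDiffOn_const).clm_apply contDiffOn_const
    · exact contDiffOn_const.mul (((contDiffOn_fderiv_metric hU hg _ _ _).add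
        (contDiffOn_fderiv_metric hU hg _ _ _)).sub (contDiffOn_fderiv_metric hU hg _ _ _))
  · exact christoffel_eq g ((hg.contDiffAt (hU.mem_nhds hy)).differentiableAt (by simp)) v w

lemma christoffel_symm {g : Eu n → Eu n →L[ℝ] Eu n →L[ℝ] ℝ} {U : Set (Eu n)} (hU : IsOpen U)
    (hg : ContDiffOn ℝ ∞ g U) (hs : ∀ y ∈ U, ∀ v w, g y v w = g y w v) {y : Eu n} (hy : y ∈ U)
    (v w : Eu n) :
    christoffel (fun z a b => g z a b) y v w = christoffel (fun z a b => g z a b) y w v := by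
  have hd := (hg.contDiffAt (hU.mem_nhds hy)).differentiableAt (by simp)
  rw [christoffel_eq g hd, christoffel_eq g hd]
  have h : ∀ x a b, fderiv ℝ g y x a b = fderiv ℝ g y x b a := by
    intro x a b
    rw [← fderiv_bilin hd, ← fderiv_bilin hd]
    congr 1
    apply Filter.EventuallyEq.fderiv_eq
    filter_upwards [hU.mem_nhds hy] with z hz using hs z hz a b
  congr 1; ext i
  refine Finset.sum_congr rfl fun l _ => ?_
  rw [koszul_apply, koszul_apply, h (e l) v w]; ring

/-- Metric compatibility: adding the Koszul formulas for `(x, v; w)` and `(x, w; v)` cancels every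
derivative except the one in the direction `x`. -/
lemma fderiv_metric {g : Eu n → Eu n →L[ℝ] Eu n →L[ℝ] ℝ} {U : Set (Eu n)} (hU : IsOpen U)
    (hg : ContDiffOn ℝ ∞ g U) (hs : ∀ y ∈ U, ∀ v w, g y v w = g y w v) {y : Eu n} (hy : y ∈ U)
    (hu : IsUnit (gram fun v w => g y v w).det) (x v w : Eu n) :
    fderiv ℝ g y x v w = g y (christoffel (fun z a b => g z a b) y x v) w
      + g y v (christoffel (fun z a b => g z a b) y x w) := by
  have hd := (hg.contDiffAt (hU.mem_nhds hy)).differentiableAt (by simp)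
  have h : ∀ x a b, fderiv ℝ g y x a b = fderiv ℝ g y x b a := by
    intro x a b
    rw [← fderiv_bilin hd, ← fderiv_bilin hd]
    congr 1
    apply Filter.EventuallyEq.fderiv_eq
    filter_upwards [hU.mem_nhds hy] with z hz using hs z hz a b
  rw [hs y hy v, inner_christoffel hd (hs y hy) hu, inner_christoffel hd (hs y hy) hu,
    koszul_apply, koszul_apply, h x w v]
  ring

end Coord

/-! ### Covariant calculus of vector fields along a map. -/

section CovariantDerivative

variable {E X F : Type*} [NormedAddCommGroup E] [NormedSpace ℝ E]
  [NormedAddCommGroup X] [NormedSpace ℝ X] [NormedAddCommGroup F] [NormedSpace ℝ F]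

/-- The covariant derivative of the field `Z` along `f` for the connection with Christoffel
symbols `Γ`. -/
def covField (Γ : E → E →L[ℝ] E →L[ℝ] E) (f Z : X → E) (u v : X) : E :=
  fderiv ℝ Z u v + Γ (f u) (fderiv ℝ f u v) (Z u)

/-- The curvature of the connection with Christoffel symbols `Γ`. -/
def curv (Γ : E → E →L[ℝ] E →L[ℝ] E) (y u v w : E) : E :=
  (fderiv ℝ Γ y u v w + Γ y u (Γ y v w)) - (fderiv ℝ Γ y v u w + Γ y v (Γ y u w))

lemma hasFDerivAt_along {B : E → F} {f : X → E} {u : X} (hB : DifferentiableAt ℝ B (f u))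
    (hf : DifferentiableAt ℝ f u) :
    HasFDerivAt (fun t => B (f t)) ((fderiv ℝ B (f u)).comp (fderiv ℝ f u)) u :=
  hB.hasFDerivAt.comp u hf.hasFDerivAt

lemma fderiv_bilin_along {B : E → E →L[ℝ] E →L[ℝ] F} {f Z W : X → E} {u : X}
    (hB : DifferentiableAt ℝ B (f u)) (hf : DifferentiableAt ℝ f u)
    (hZ : DifferentiableAt ℝ Z u) (hW : DifferentiableAt ℝ W u) (v : X) :
    fderiv ℝ (fun t => B (f t) (Z t) (W t)) u v
      = fderiv ℝ B (f u) (fderiv ℝ f u v) (Z u) (W u) + B (f u) (fderiv ℝ Z u v) (W u)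
        + B (f u) (Z u) (fderiv ℝ W u v) := by
  have h0 := hasFDerivAt_along (F := E →L[ℝ] E →L[ℝ] F) hB hf
  have h1 : HasFDerivAt (fun t => B (f t) (Z t)) _ u := h0.clm_apply hZ.hasFDerivAt
  have h2 : HasFDerivAt (fun t => B (f t) (Z t) (W t)) _ u := h1.clm_apply hW.hasFDerivAt
  rw [h2.fderiv]
  simp
  abel

lemma fderiv_linear_along {B : E → E →L[ℝ] F} {f Z : X → E} {u : X}
    (hB : DifferentiableAt ℝ B (f u)) (hf : DifferentiableAt ℝ f u)
    (hZ : DifferentiableAt ℝ Z u) (v : X) :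
    fderiv ℝ (fun t => B (f t) (Z t)) u v
      = fderiv ℝ B (f u) (fderiv ℝ f u v) (Z u) + B (f u) (fderiv ℝ Z u v) := by
  have h0 := hasFDerivAt_along hB hf
  have h1 : HasFDerivAt (fun t => B (f t) (Z t)) _ u := h0.clm_apply hZ.hasFDerivAt
  rw [h1.fderiv]
  simp
  abel

lemma fderiv_fderiv_apply {Z : X → F} {w : X → X} {u : X}
    (hZ : DifferentiableAt ℝ (fderiv ℝ Z) u) (hw : DifferentiableAt ℝ w u) (v : X) :
    fderiv ℝ (fun t => fderiv ℝ Z t (w t)) u v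
      = fderiv ℝ (fderiv ℝ Z) u v (w u) + fderiv ℝ Z u (fderiv ℝ w u v) := by
  have h1 : HasFDerivAt (fun t => fderiv ℝ Z t (w t)) _ u := hZ.hasFDerivAt.clm_apply hw.hasFDerivAt
  rw [h1.fderiv]
  simp
  abel

lemma differentiableAt_fderiv {Z : X → F} {u : X} (hZ : ContDiffAt ℝ ∞ Z u) :
    DifferentiableAt ℝ (fderiv ℝ Z) u :=
  (hZ.fderiv_right (m := ∞) (by simp)).differentiableAt (by simp)

lemma contDiffAt_fderiv_apply {Z : X → F} {w : X → X} {u : X} (hZ : ContDiffAt ℝ ∞ Z u)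
    (hw : ContDiffAt ℝ ∞ w u) : ContDiffAt ℝ ∞ (fun t => fderiv ℝ Z t (w t)) u :=
  (hZ.fderiv_right (m := ∞) (by simp)).clm_apply hw

lemma fderiv_fderiv_symm {Z : X → F} {u : X} (hZ : ContDiffAt ℝ ∞ Z u) (v w : X) :
    fderiv ℝ (fderiv ℝ Z) u v w = fderiv ℝ (fderiv ℝ Z) u w v :=
  (hZ.isSymmSndFDerivAt (by simpa using WithTop.coe_le_coe.2 (le_top : (2 : ℕ∞) ≤ ⊤))).eq v w

lemma contDiffAt_covField {Γ : E → E →L[ℝ] E →L[ℝ] E} {f Z : X → E} {w : X → X} {u : X}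
    (hΓ : ContDiffAt ℝ ∞ Γ (f u)) (hf : ContDiffAt ℝ ∞ f u) (hZ : ContDiffAt ℝ ∞ Z u)
    (hw : ContDiffAt ℝ ∞ w u) : ContDiffAt ℝ ∞ (fun t => covField Γ f Z t (w t)) u :=
  (contDiffAt_fderiv_apply hZ hw).add
    (((hΓ.comp u hf).clm_apply (contDiffAt_fderiv_apply hf hw)).clm_apply hZ)

lemma covField_congr (Γ : E → E →L[ℝ] E →L[ℝ] E) (f : X → E) {Z W : X → E} {u : X}
    (h : Z =ᶠ[nhds u] W) (v : X) : covField Γ f Z u v = covField Γ f W u v := by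
  rw [covField, covField, h.fderiv_eq, h.eq_of_nhds]

lemma fderiv_inner_along {g : E → E →L[ℝ] E →L[ℝ] ℝ} {Γ : E → E →L[ℝ] E →L[ℝ] E}
    {f Z W : X → E} {u : X} (hg : DifferentiableAt ℝ g (f u))
    (hc : ∀ x a b, fderiv ℝ g (f u) x a b = g (f u) (Γ (f u) x a) b + g (f u) a (Γ (f u) x b))
    (hf : DifferentiableAt ℝ f u) (hZ : DifferentiableAt ℝ Z u) (hW : DifferentiableAt ℝ W u)
    (v : X) :
    fderiv ℝ (fun t => g (f t) (Z t) (W t)) u v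
      = g (f u) (covField Γ f Z u v) (W u) + g (f u) (Z u) (covField Γ f W u v) := by
  rw [fderiv_bilin_along hg hf hZ hW, hc]
  simp only [covField, map_add, _root_.add_apply]
  ring

lemma covField_fderiv_symm {Γ : E → E →L[ℝ] E →L[ℝ] E} {f : X → E} {u : X}
    (ht : ∀ a b, Γ (f u) a b = Γ (f u) b a) (hf : ContDiffAt ℝ ∞ f u) (v w : X) :
    covField Γ f (fun t => fderiv ℝ f t w) u v = covField Γ f (fun t => fderiv ℝ f t v) u w := by
  have hd := differentiableAt_fderiv hf
  simp only [covField]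
  rw [fderiv_fderiv_apply hd (differentiableAt_const w),
    fderiv_fderiv_apply hd (differentiableAt_const v), fderiv_fderiv_symm hf v w, ht]
  simp

lemma covField_smul {Γ : E → E →L[ℝ] E →L[ℝ] E} {f Z : X → E} {h : X → ℝ} {u : X}
    (hh : DifferentiableAt ℝ h u) (hZ : DifferentiableAt ℝ Z u) (v : X) :
    covField Γ f (fun t => h t • Z t) u v = fderiv ℝ h u v • Z u + h u • covField Γ f Z u v := by
  have : HasFDerivAt (fun t => h t • Z t) _ u := hh.hasFDerivAt.smul hZ.hasFDerivAt
  rw [covField, this.fderiv]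
  simp [covField]; abel

/-- The product rule for a moving direction `w`: freezing `w` at `u` costs one first-order term. It
allows identities holding along the nonconstant field `ξ` to be differentiated. -/
lemma covField_covField_apply {Γ : E → E →L[ℝ] E →L[ℝ] E} {f Z : X → E} {w : X → X} {u : X}
    (hΓ : ContDiffAt ℝ ∞ Γ (f u)) (hf : ContDiffAt ℝ ∞ f u) (hZ : ContDiffAt ℝ ∞ Z u)
    (hw : DifferentiableAt ℝ w u) (v : X) :
    covField Γ f (fun t => covField Γ f Z t (w t)) u v
      = covField Γ f (fun t => covField Γ f Z t (w u)) u v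
        + covField Γ f Z u (fderiv ℝ w u v) := by
  have dG := hΓ.differentiableAt (by simp)
  have df := hf.differentiableAt (by simp)
  have dZ := hZ.differentiableAt (by simp)
  have ddf := differentiableAt_fderiv hf
  have ddZ := differentiableAt_fderiv hZ
  -- The full expansion for an arbitrary direction field; applied to `w` and to the constant field
  -- `w u`, the two results differ only in the terms with `fderiv ℝ w u v`.
  have key : ∀ w : X → X, DifferentiableAt ℝ w u →
      fderiv ℝ (fun t => covField Γ f Z t (w t)) u v
        = fderiv ℝ (fderiv ℝ Z) u v (w u) + fderiv ℝ Z u (fderiv ℝ w u v)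
          + (fderiv ℝ Γ (f u) (fderiv ℝ f u v) (fderiv ℝ f u (w u)) (Z u)
            + Γ (f u) (fderiv ℝ (fderiv ℝ f) u v (w u) + fderiv ℝ f u (fderiv ℝ w u v)) (Z u)
            + Γ (f u) (fderiv ℝ f u (w u)) (fderiv ℝ Z u v)) := by
    intro w hw
    have h1 : DifferentiableAt ℝ (fun t => fderiv ℝ Z t (w t)) u := ddZ.clm_apply hw
    have h2 : DifferentiableAt ℝ (fun t => fderiv ℝ f t (w t)) u := ddf.clm_apply hw
    have h3 : DifferentiableAt ℝ (fun t => Γ (f t)) u :=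
      (hasFDerivAt_along (F := E →L[ℝ] E →L[ℝ] E) dG df).differentiableAt
    have h4 : DifferentiableAt ℝ (fun t => Γ (f t) (fderiv ℝ f t (w t)) (Z t)) u :=
      (h3.clm_apply h2).clm_apply dZ
    simp only [covField]
    rw [fderiv_fun_add h1 h4, _root_.add_apply, fderiv_fderiv_apply ddZ hw,
      fderiv_bilin_along dG df h2 dZ, fderiv_fderiv_apply ddf hw]
  have e1 := key w hw
  have e2 := key (fun _ => w u) (differentiableAt_const _)
  rw [covField, e1]
  unfold covField at e2 ⊢
  rw [e2]
  simp
  abel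

/-- The Ricci identity. Second derivatives of `Z` and of `f` are symmetric and cancel, leaving the
curvature; no bracket term appears because `v` and `w` are constant. -/
lemma covField_comm {Γ : E → E →L[ℝ] E →L[ℝ] E} {f Z : X → E} {u : X}
    (hΓ : ContDiffAt ℝ ∞ Γ (f u)) (hf : ContDiffAt ℝ ∞ f u) (hZ : ContDiffAt ℝ ∞ Z u) (v w : X) :
    covField Γ f (fun t => covField Γ f Z t w) u v
      = covField Γ f (fun t => covField Γ f Z t v) u w
        + curv Γ (f u) (fderiv ℝ f u v) (fderiv ℝ f u w) (Z u) := by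
  have dG := hΓ.differentiableAt (by simp)
  have df := hf.differentiableAt (by simp)
  have dZ := hZ.differentiableAt (by simp)
  have ddf := differentiableAt_fderiv hf
  have ddZ := differentiableAt_fderiv hZ
  have key : ∀ v w : X, fderiv ℝ (fun t => covField Γ f Z t w) u v
        = fderiv ℝ (fderiv ℝ Z) u v w
          + (fderiv ℝ Γ (f u) (fderiv ℝ f u v) (fderiv ℝ f u w) (Z u)
            + Γ (f u) (fderiv ℝ (fderiv ℝ f) u v w) (Z u)
            + Γ (f u) (fderiv ℝ f u w) (fderiv ℝ Z u v)) := by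
    intro v w
    have hw : DifferentiableAt ℝ (fun _ : X => w) u := differentiableAt_const w
    have h1 : DifferentiableAt ℝ (fun t => fderiv ℝ Z t w) u := ddZ.clm_apply hw
    have h2 : DifferentiableAt ℝ (fun t => fderiv ℝ f t w) u := ddf.clm_apply hw
    have h3 : DifferentiableAt ℝ (fun t => Γ (f t)) u :=
      (hasFDerivAt_along (F := E →L[ℝ] E →L[ℝ] E) dG df).differentiableAt
    have h4 : DifferentiableAt ℝ (fun t => Γ (f t) (fderiv ℝ f t w) (Z t)) u :=
      (h3.clm_apply h2).clm_apply dZ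
    simp only [covField]
    rw [fderiv_fun_add h1 h4, _root_.add_apply, fderiv_fderiv_apply ddZ hw,
      fderiv_bilin_along dG df h2 dZ, fderiv_fderiv_apply ddf hw]
    simp
  have e1 := key v w
  have e2 := key w v
  unfold covField at e1 e2 ⊢
  rw [e1, e2, fderiv_fderiv_symm hZ v w, fderiv_fderiv_symm hf v w]
  simp [curv]
  abel

end CovariantDerivative

/-! ### Contact metric structures in a chart and their hypersurfaces -/

section ContactChart

variable {E X : Type*} [NormedAddCommGroup E] [NormedSpace ℝ E]
  [NormedAddCommGroup X] [NormedSpace ℝ X]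

/-- A Sasakian structure on an open set, with the Levi-Civita connection `Γ`. -/
structure SasakianChart (U : Set E) (g : E → E →L[ℝ] E →L[ℝ] ℝ) (Γ : E → E →L[ℝ] E →L[ℝ] E)
    (φ : E → E →L[ℝ] E) (ξ : E → E) : Prop where
  isOpen : IsOpen U
  smooth_g : ContDiffOn ℝ ∞ g U
  smooth_Γ : ContDiffOn ℝ ∞ Γ U
  smooth_φ : ContDiffOn ℝ ∞ φ U
  smooth_ξ : ContDiffOn ℝ ∞ ξ U
  symm : ∀ y ∈ U, ∀ v w, g y v w = g y w v
  pos : ∀ y ∈ U, ∀ v, v ≠ 0 → 0 < g y v v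
  unit_ξ : ∀ y ∈ U, g y (ξ y) (ξ y) = 1
  φ_ξ : ∀ y ∈ U, φ y (ξ y) = 0
  φ_sq : ∀ y ∈ U, ∀ v, φ y (φ y v) = -v + g y (ξ y) v • ξ y
  skew : ∀ y ∈ U, ∀ v w, g y (φ y v) w = -g y v (φ y w)
  metric : ∀ y ∈ U, ∀ x a b, fderiv ℝ g y x a b = g y (Γ y x a) b + g y a (Γ y x b)
  torsion : ∀ y ∈ U, ∀ a b, Γ y a b = Γ y b a
  cov_ξ : ∀ y ∈ U, ∀ v, fderiv ℝ ξ y v + Γ y v (ξ y) = -φ y v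
  cov_φ : ∀ y ∈ U, ∀ v w,
    fderiv ℝ φ y v w + Γ y v (φ y w) - φ y (Γ y v w) = g y v w • ξ y - g y (ξ y) w • v
  curv_ξ : ∀ y ∈ U, ∀ v w, curv Γ y (ξ y) v w = g y v w • ξ y - g y (ξ y) w • v

/-- A hypersurface of a Sasakian chart with unit normal `ν`, to which `ξ` is tangent. -/
structure ContactHypersurface (U : Set E) (g : E → E →L[ℝ] E →L[ℝ] ℝ)
    (ξ : E → E) (O : Set X) (f ν : X → E) (w : X → X) : Prop where
  isOpen : IsOpen O
  maps : ∀ t ∈ O, f t ∈ U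
  smooth_f : ContDiffOn ℝ ∞ f O
  smooth_ν : ContDiffOn ℝ ∞ ν O
  smooth_w : ContDiffOn ℝ ∞ w O
  unit : ∀ t ∈ O, g (f t) (ν t) (ν t) = 1
  normal : ∀ t ∈ O, ∀ v, g (f t) (ν t) (fderiv ℝ f t v) = 0
  spans : ∀ t ∈ O, ∀ x, (∀ v, g (f t) x (fderiv ℝ f t v) = 0) → g (f t) x (ν t) = 0 → x = 0
  w_eq : ∀ t ∈ O, fderiv ℝ f t (w t) = ξ (f t)

namespace SasakianChart

variable {U : Set E} {g : E → E →L[ℝ] E →L[ℝ] ℝ} {Γ : E → E →L[ℝ] E →L[ℝ] E}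
  {φ : E → E →L[ℝ] E} {ξ : E → E} (S : SasakianChart U g Γ φ ξ)
  {f Z W : X → E} {u : X}

include S

lemma g_φ_self {y : E} (hy : y ∈ U) (v : E) : g y (φ y v) v = 0 := by
  have := S.skew y hy v v
  rw [S.symm y hy v] at this; linarith

lemma η_φ {y : E} (hy : y ∈ U) (v : E) : g y (ξ y) (φ y v) = 0 := by
  have := S.skew y hy (ξ y) v
  rw [S.φ_ξ y hy] at this; simpa using this.symm

lemma fderiv_inner (hu : f u ∈ U) (hf : DifferentiableAt ℝ f u)
    (hZ : DifferentiableAt ℝ Z u) (hW : DifferentiableAt ℝ W u) (v : X) :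
    fderiv ℝ (fun t => g (f t) (Z t) (W t)) u v
      = g (f u) (covField Γ f Z u v) (W u) + g (f u) (Z u) (covField Γ f W u v) :=
  fderiv_inner_along ((S.smooth_g.contDiffAt (S.isOpen.mem_nhds hu)).differentiableAt (by simp))
    (S.metric _ hu) hf hZ hW v

lemma covField_ξ (hu : f u ∈ U) (hf : DifferentiableAt ℝ f u) (v : X) :
    covField Γ f (fun t => ξ (f t)) u v = -φ (f u) (fderiv ℝ f u v) := by
  have dx := (S.smooth_ξ.contDiffAt (S.isOpen.mem_nhds hu)).differentiableAt (by simp)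
  have : HasFDerivAt (fun t => ξ (f t)) _ u := dx.hasFDerivAt.comp u hf.hasFDerivAt
  rw [covField, this.fderiv, ← S.cov_ξ _ hu]
  rfl

lemma covField_φ (hu : f u ∈ U) (hf : DifferentiableAt ℝ f u) (hZ : DifferentiableAt ℝ Z u)
    (v : X) :
    covField Γ f (fun t => φ (f t) (Z t)) u v = φ (f u) (covField Γ f Z u v)
      + g (f u) (fderiv ℝ f u v) (Z u) • ξ (f u) - g (f u) (ξ (f u)) (Z u) • fderiv ℝ f u v := by
  have dx := (S.smooth_φ.contDiffAt (S.isOpen.mem_nhds hu)).differentiableAt (by simp)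
  have := S.cov_φ _ hu (fderiv ℝ f u v) (Z u)
  rw [covField, fderiv_linear_along dx hf hZ, covField, map_add, add_sub_assoc, ← this]
  abel

end SasakianChart

namespace ContactHypersurface

variable {U : Set E} {g : E → E →L[ℝ] E →L[ℝ] ℝ} {Γ : E → E →L[ℝ] E →L[ℝ] E}
  {φ : E → E →L[ℝ] E} {ξ : E → E} (S : SasakianChart U g Γ φ ξ)
  {O : Set X} {f ν : X → E} {w : X → X} (M : ContactHypersurface U g ξ O f ν w) {u : X}

include M

lemma contDiffAt_f (hu : u ∈ O) : ContDiffAt ℝ ∞ f u :=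
  M.smooth_f.contDiffAt (M.isOpen.mem_nhds hu)

lemma contDiffAt_ν (hu : u ∈ O) : ContDiffAt ℝ ∞ ν u :=
  M.smooth_ν.contDiffAt (M.isOpen.mem_nhds hu)

lemma contDiffAt_w (hu : u ∈ O) : ContDiffAt ℝ ∞ w u :=
  M.smooth_w.contDiffAt (M.isOpen.mem_nhds hu)

lemma differentiableAt_f (hu : u ∈ O) : DifferentiableAt ℝ f u :=
  (M.contDiffAt_f hu).differentiableAt (by simp)

lemma differentiableAt_ν (hu : u ∈ O) : DifferentiableAt ℝ ν u :=
  (M.contDiffAt_ν hu).differentiableAt (by simp)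

lemma differentiableAt_fderiv_f (hu : u ∈ O) (v : X) :
    DifferentiableAt ℝ (fun t => fderiv ℝ f t v) u :=
  (contDiffAt_fderiv_apply (M.contDiffAt_f hu) contDiffAt_const).differentiableAt (by simp)

lemma normal_ξ (hu : u ∈ O) : g (f u) (ν u) (ξ (f u)) = 0 := by
  rw [← M.w_eq u hu]; exact M.normal u hu _

include S

lemma inner_covField_ν (hu : u ∈ O) (v x : X) :
    g (f u) (covField Γ f ν u v) (fderiv ℝ f u x)
      = -g (f u) (ν u) (covField Γ f (fun t => fderiv ℝ f t x) u v) := by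
  have h0 : (fun t => g (f t) (ν t) (fderiv ℝ f t x)) =ᶠ[nhds u] fun _ => 0 := by
    filter_upwards [M.isOpen.mem_nhds hu] with t ht using M.normal t ht x
  have := S.fderiv_inner (M.maps u hu) (M.differentiableAt_f hu) (M.differentiableAt_ν hu)
    (M.differentiableAt_fderiv_f hu x) v
  rw [h0.fderiv_eq] at this
  simp at this; linarith

/-- Symmetry of the second fundamental form, inherited from the vanishing torsion. -/
lemma inner_covField_ν_symm (hu : u ∈ O) (v x : X) :
    g (f u) (covField Γ f ν u v) (fderiv ℝ f u x)
      = g (f u) (covField Γ f ν u x) (fderiv ℝ f u v) := by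
  rw [inner_covField_ν S M hu, inner_covField_ν S M hu,
    covField_fderiv_symm (S.torsion _ (M.maps u hu)) (M.contDiffAt_f hu)]

/-- Differentiate `g(ν, ξ) = 0` and insert `∇_v ξ = -φ v`. -/
lemma inner_covField_ν_ξ (hu : u ∈ O) (v : X) :
    g (f u) (covField Γ f ν u v) (ξ (f u)) = g (f u) (ν u) (φ (f u) (fderiv ℝ f u v)) := by
  have h0 : (fun t => g (f t) (ν t) (ξ (f t))) =ᶠ[nhds u] fun _ => 0 := by
    filter_upwards [M.isOpen.mem_nhds hu] with t ht using M.normal_ξ ht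
  have dx := (S.smooth_ξ.contDiffAt (S.isOpen.mem_nhds (M.maps u hu))).differentiableAt (by simp)
  have := S.fderiv_inner (M.maps u hu) (M.differentiableAt_f hu) (M.differentiableAt_ν hu)
    (dx.comp u (M.differentiableAt_f hu)) v
  have h1 := S.covField_ξ (M.maps u hu) (M.differentiableAt_f hu) v
  simp only [Function.comp_def] at this
  rw [h0.fderiv_eq, h1] at this
  simp at this; linarith

lemma inner_covField_ν_ν (hu : u ∈ O) (v : X) : g (f u) (covField Γ f ν u v) (ν u) = 0 := by
  have h0 : (fun t => g (f t) (ν t) (ν t)) =ᶠ[nhds u] fun _ => 1 := by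
    filter_upwards [M.isOpen.mem_nhds hu] with t ht using M.unit t ht
  have := S.fderiv_inner (M.maps u hu) (M.differentiableAt_f hu) (M.differentiableAt_ν hu)
    (M.differentiableAt_ν hu) v
  rw [h0.fderiv_eq, S.symm _ (M.maps u hu) (ν u)] at this
  simp at this; linarith

/-- `A ξ = -V`. -/
lemma covField_ν_w (hu : u ∈ O) : covField Γ f ν u (w u) = -φ (f u) (ν u) := by
  have hU := M.maps u hu
  rw [← sub_eq_zero, sub_neg_eq_add]
  -- Both sides are compared with tangent vectors, where symmetry moves the derivative onto `ξ`, and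
  -- with `ν`, where both components are zero.
  refine M.spans u hu _ (fun v => ?_) ?_
  · rw [map_add, _root_.add_apply, inner_covField_ν_symm S M hu, M.w_eq u hu,
      inner_covField_ν_ξ S M hu, S.skew _ hU]
    ring
  · rw [map_add, _root_.add_apply, inner_covField_ν_ν S M hu, S.g_φ_self hU, add_zero]

/-- As the torsion vanishes, `∇_ξ v = ∇_v ξ + [ξ, v]`; the bracket of `w` with the constant field
`v` is `-fderiv ℝ w u v`. -/
lemma covField_fderiv_w (hu : u ∈ O) (v : X) :
    covField Γ f (fun t => fderiv ℝ f t v) u (w u)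
      = -φ (f u) (fderiv ℝ f u v) - fderiv ℝ f u (fderiv ℝ w u v) := by
  have hU := M.maps u hu
  have hw := (M.contDiffAt_w hu).differentiableAt (by simp)
  have ddf := differentiableAt_fderiv (M.contDiffAt_f hu)
  have h1 : (fun t => fderiv ℝ f t (w t)) =ᶠ[nhds u] fun t => ξ (f t) := by
    filter_upwards [M.isOpen.mem_nhds hu] with t ht using M.w_eq t ht
  have h2 := covField_congr Γ f h1 v
  rw [S.covField_ξ hU (M.differentiableAt_f hu)] at h2
  rw [← covField_fderiv_symm (S.torsion _ hU) (M.contDiffAt_f hu), ← h2, covField, covField,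
    fderiv_fderiv_apply ddf hw, fderiv_fderiv_apply ddf (differentiableAt_const _)]
  simp
  abel

/-- The commutation of `∇ν` with the flow of `ξ`: differentiate `∇_ξ ν = -φ ν` in the direction `v`
and exchange the two derivatives. The correction `R(ξ, v) ν = g(v, ν) ξ - η(ν) v` is zero, since `ν`
is orthogonal to `v` and to `ξ`. -/
lemma covField_covField_ν_w (hu : u ∈ O) (v : X) :
    covField Γ f (fun t => covField Γ f ν t v) u (w u)
      = -φ (f u) (covField Γ f ν u v) - covField Γ f ν u (fderiv ℝ w u v) := by
  have hU := M.maps u hu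
  have hw := (M.contDiffAt_w hu).differentiableAt (by simp)
  have hG := S.smooth_Γ.contDiffAt (S.isOpen.mem_nhds hU)
  -- The identity holds on a neighbourhood, so it may be differentiated.
  have h1 : (fun t => covField Γ f ν t (w t)) =ᶠ[nhds u] fun t => (-1 : ℝ) • φ (f t) (ν t) := by
    filter_upwards [M.isOpen.mem_nhds hu] with t ht
    rw [covField_ν_w S M ht]; simp
  have dφ := (S.smooth_φ.contDiffAt (S.isOpen.mem_nhds hU)).differentiableAt (by simp)
  have h2 := covField_congr Γ f h1 v
  have dφν : DifferentiableAt ℝ (fun t => φ (f t) (ν t)) u :=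
    (hasFDerivAt_along dφ (M.differentiableAt_f hu)).differentiableAt.clm_apply
      (M.differentiableAt_ν hu)
  rw [covField_smul (differentiableAt_const _) dφν,
    S.covField_φ hU (M.differentiableAt_f hu) (M.differentiableAt_ν hu),
    covField_covField_apply hG (M.contDiffAt_f hu) (M.contDiffAt_ν hu) hw,
    S.symm _ hU _ (ν u), M.normal u hu, S.symm _ hU (ξ _), M.normal_ξ hu] at h2
  rw [covField_comm hG (M.contDiffAt_f hu) (M.contDiffAt_ν hu), M.w_eq u hu, S.curv_ξ _ hU,
    S.symm _ hU _ (ν u), M.normal u hu, S.symm _ hU (ξ _), M.normal_ξ hu,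
    eq_sub_of_add_eq h2]
  simp

/-- The Lie derivative along `ξ` of the second fundamental form vanishes. -/
lemma fderiv_inner_covField_ν (hu : u ∈ O) (v x : X) :
    fderiv ℝ (fun t => g (f t) (covField Γ f ν t v) (fderiv ℝ f t x)) u (w u)
      = -g (f u) (covField Γ f ν u (fderiv ℝ w u v)) (fderiv ℝ f u x)
        - g (f u) (covField Γ f ν u v) (fderiv ℝ f u (fderiv ℝ w u x)) := by
  have hU := M.maps u hu
  have hG := S.smooth_Γ.contDiffAt (S.isOpen.mem_nhds hU)
  rw [S.fderiv_inner hU (M.differentiableAt_f hu)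
    ((contDiffAt_covField hG (M.contDiffAt_f hu) (M.contDiffAt_ν hu)
      contDiffAt_const).differentiableAt (by simp)) (M.differentiableAt_fderiv_f hu x),
    covField_covField_ν_w S M hu, covField_fderiv_w S M hu]
  -- The two terms containing `φ` cancel by skewness; only the bracket terms with `fderiv ℝ w u`
  -- survive.
  simp only [map_sub, map_neg, _root_.sub_apply, _root_.neg_apply, S.skew _ hU]
  ring

/-- The Lie derivative along `ξ` of the induced metric vanishes. -/
lemma fderiv_inner_fderiv (hu : u ∈ O) (v x : X) :
    fderiv ℝ (fun t => g (f t) (fderiv ℝ f t v) (fderiv ℝ f t x)) u (w u)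
      = -g (f u) (fderiv ℝ f u (fderiv ℝ w u v)) (fderiv ℝ f u x)
        - g (f u) (fderiv ℝ f u v) (fderiv ℝ f u (fderiv ℝ w u x)) := by
  have hU := M.maps u hu
  rw [S.fderiv_inner hU (M.differentiableAt_f hu)
    (M.differentiableAt_fderiv_f hu v) (M.differentiableAt_fderiv_f hu x),
    covField_fderiv_w S M hu, covField_fderiv_w S M hu]
  simp only [map_sub, map_neg, _root_.sub_apply, _root_.neg_apply, S.skew _ hU]
  ring

end ContactHypersurface

end ContactChart

/-! ### The trace of the second fundamental form along `ξ`. -/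

lemma sum_symm_mul_antisymm {k : ℕ} (M Ω : Matrix (Fin k) (Fin k) ℝ) (hM : ∀ i j, M i j = M j i)
    (hΩ : ∀ i j, Ω i j = -Ω j i) : ∑ i, ∑ j, M i j * Ω i j = 0 := by
  have h : ∑ i, ∑ j, M i j * Ω i j = -∑ i, ∑ j, M i j * Ω i j := by
    conv_rhs => rw [Finset.sum_comm]
    rw [← Finset.sum_neg_distrib]
    refine Finset.sum_congr rfl fun i _ => ?_
    rw [← Finset.sum_neg_distrib]
    refine Finset.sum_congr rfl fun j _ => ?_
    rw [hM j i, hΩ i j]; ring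
  linarith

/-- If the Lie derivatives of a metric and of a bilinear form vanish, so does
that of the trace. -/
lemma sum_deriv_trace_eq_zero {k : ℕ} {I G I' G' a a' Q : Matrix (Fin k) (Fin k) ℝ}
    (hI : I * G = 1) (h' : I' * G + I * G' = 0) (hG : G' = -(Q.transpose * G) - G * Q)
    (ha : a' = -(Q.transpose * a) - a * Q) :
    ∑ i, ∑ j, (I' i j * a i j + I i j * a' i j) = 0 := by
  have hI2 : G * I = 1 := mul_eq_one_comm.1 hI
  -- Obtained by differentiating `I * G = 1`: the inverse metric transforms with the opposite sign.
  -- The contributions of `Q` to the trace then cancel by cyclicity.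
  have e1 : I' = I * Q.transpose + Q * I := by
    have : I' * G * I = -(I * G' * I) := by
      rw [eq_neg_of_add_eq_zero_left h', neg_mul]
    rw [mul_assoc, hI2, mul_one, hG] at this
    rw [this, mul_sub, sub_mul, mul_neg, neg_mul, ← mul_assoc I G Q, hI, one_mul,
      mul_assoc I _ I, mul_assoc _ G I, hI2, mul_one]
    abel
  have e2 : ∑ i, ∑ j, (I' i j * a i j + I i j * a' i j)
      = (I' * a.transpose + I * a'.transpose).trace := by
    simp [Matrix.trace, Matrix.mul_apply, Finset.sum_add_distrib]
  rw [e2, e1, ha]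
  simp only [Matrix.transpose_sub, Matrix.transpose_neg, Matrix.transpose_mul,
    Matrix.transpose_transpose, mul_sub, mul_neg, add_mul, Matrix.trace_add, Matrix.trace_sub,
    Matrix.trace_neg]
  have c1 : (Q * I * a.transpose).trace = (I * (a.transpose * Q)).trace := by
    rw [mul_assoc, Matrix.trace_mul_comm, mul_assoc]
  rw [c1, mul_assoc I]
  ring

open Coord

namespace ContactHypersurface

variable {n k : ℕ} {U : Set (Eu n)} {g : Eu n → Eu n →L[ℝ] Eu n →L[ℝ] ℝ}
  {Γ : Eu n → Eu n →L[ℝ] Eu n →L[ℝ] Eu n}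
  {φ : Eu n → Eu n →L[ℝ] Eu n} {ξ : Eu n → Eu n} (S : SasakianChart U g Γ φ ξ)
  {O : Set (Eu k)} {f ν : Eu k → Eu n} {w : Eu k → Eu k}
  (M : ContactHypersurface U g ξ O f ν w) {u : Eu k}

/-- The induced metric as a field of bilinear forms. -/
def inducedForm (g : Eu n → Eu n →L[ℝ] Eu n →L[ℝ] ℝ) (f : Eu k → Eu n) (u : Eu k) :
    Eu k →L[ℝ] Eu k →L[ℝ] ℝ :=
  (g (f u)).bilinearComp (fderiv ℝ f u) (fderiv ℝ f u)

lemma inducedForm_apply (g : Eu n → Eu n →L[ℝ] Eu n →L[ℝ] ℝ) (f : Eu k → Eu n) (u v x : Eu k) :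
    inducedForm g f u v x = g (f u) (fderiv ℝ f u v) (fderiv ℝ f u x) := rfl

lemma induced_eq (g : Eu n → Eu n →L[ℝ] Eu n →L[ℝ] ℝ) (f : Eu k → Eu n) :
    induced (fun y a b => g y a b) f = fun u v x => inducedForm g f u v x := rfl

lemma contDiffOn_inducedForm (hO : IsOpen O) (hf : ContDiffOn ℝ ∞ f O) (hm : ∀ t ∈ O, f t ∈ U)
    (hg : ContDiffOn ℝ ∞ g U) : ContDiffOn ℝ ∞ (inducedForm g f) O := by
  rw [contDiffOn_clm_apply_iff₂]
  intro v x
  have hf' : ∀ v, ContDiffOn ℝ ∞ (fun t => fderiv ℝ f t v) O := fun v =>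
    (hf.fderiv_of_isOpen hO (by simp)).clm_apply contDiffOn_const
  exact ((hg.comp hf fun t ht => hm t ht).clm_apply (hf' v)).clm_apply (hf' x)

include M

include S

lemma inducedForm_symm (hu : u ∈ O) (v x : Eu k) :
    inducedForm g f u v x = inducedForm g f u x v :=
  S.symm _ (M.maps u hu) _ _

lemma isUnit_det_inducedForm (hinj : Function.Injective (fderiv ℝ f u)) (hu : u ∈ O) :
    IsUnit (gram fun v x => inducedForm g f u v x).det :=
  isUnit_det_gram_of_pos _ fun _ hv => S.pos _ (M.maps u hu) _ fun h =>
    hv (hinj (h.trans (map_zero _).symm))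

/-- Vectors orthogonal to the normal are tangent. -/
lemma exists_tangent (hinj : Function.Injective (fderiv ℝ f u)) (hu : u ∈ O) {x : Eu n}
    (hx : g (f u) x (ν u) = 0) : ∃ y, fderiv ℝ f u y = x := by
  let K : Eu k →L[ℝ] ℝ := (g (f u) x).comp (fderiv ℝ f u)
  refine ⟨WithLp.toLp 2 fun i => ∑ l, (gram fun v w => inducedForm g f u v w)⁻¹ i l * K (e l), ?_⟩
  rw [← sub_eq_zero]
  refine M.spans u hu _ (fun v => ?_) ?_
  · have := inner_toLp_gram_inv (inducedForm g f u) (inducedForm_symm S M hu)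
      (isUnit_det_inducedForm S M hinj hu) K v
    rw [inducedForm_apply] at this
    rw [map_sub, _root_.sub_apply, this]
    simp [K]
  · rw [map_sub, _root_.sub_apply, hx, S.symm _ (M.maps u hu), M.normal u hu, sub_zero]

/-- The Gauss formula: the tangential part of the ambient derivative is the induced Levi-Civita
connection. Expanding the derivatives of the induced metric by ambient metric compatibility in the
Koszul formula, and using the symmetry of `∇ df`, leaves only this term. -/
lemma inner_christoffel_induced (hinj : Function.Injective (fderiv ℝ f u)) (hu : u ∈ O)
    (v x z : Eu k) :
    g (f u) (fderiv ℝ f u (christoffel (induced (fun y a b => g y a b) f) u v x)) (fderiv ℝ f u z)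
      = g (f u) (covField Γ f (fun t => fderiv ℝ f t x) u v) (fderiv ℝ f u z) := by
  have hU := M.maps u hu
  have hd : DifferentiableAt ℝ (inducedForm g f) u :=
    ((contDiffOn_inducedForm M.isOpen M.smooth_f M.maps S.smooth_g).contDiffAt
      (M.isOpen.mem_nhds hu)).differentiableAt
      (by simp)
  have h := inner_christoffel hd (inducedForm_symm S M hu) (isUnit_det_inducedForm S M hinj hu)
    v x z
  have hD : ∀ a b c, fderiv ℝ (inducedForm g f) u a b c
      = g (f u) (covField Γ f (fun t => fderiv ℝ f t b) u a) (fderiv ℝ f u c)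
        + g (f u) (fderiv ℝ f u b) (covField Γ f (fun t => fderiv ℝ f t c) u a) := by
    intro a b c
    rw [← fderiv_bilin hd]
    exact S.fderiv_inner hU (M.differentiableAt_f hu) (M.differentiableAt_fderiv_f hu b)
      (M.differentiableAt_fderiv_f hu c) a
  rw [koszul_apply, hD, hD, hD] at h
  rw [induced_eq]
  refine h.trans ?_
  have ht := fun a b => covField_fderiv_symm (S.torsion _ hU) (M.contDiffAt_f hu) a b
  rw [ht x v, ht x z, ht v z, S.symm _ hU (fderiv ℝ f u x), S.symm _ hU (fderiv ℝ f u v)]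
  ring

omit S in
lemma exists_smul_normal (hu : u ∈ O) {x : Eu n} (hx : ∀ v, g (f u) x (fderiv ℝ f u v) = 0) :
    x = g (f u) x (ν u) • ν u := by
  rw [← sub_eq_zero]
  refine M.spans u hu _ (fun v => ?_) ?_
  · simp [hx, M.normal u hu]
  · simp [M.unit u hu]

omit M S in
/-- The trace of `(v, x) ↦ g(∇_v ν, f_* x)` for the induced metric. -/
def traceNu (g : Eu n → Eu n →L[ℝ] Eu n →L[ℝ] ℝ) (Γ : Eu n → Eu n →L[ℝ] Eu n →L[ℝ] Eu n)
    (f ν : Eu k → Eu n) (t : Eu k) : ℝ :=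
  ∑ i, ∑ j, (gram fun v x => inducedForm g f t v x)⁻¹ i j
    * g (f t) (covField Γ f ν t (e i)) (fderiv ℝ f t (e j))

lemma contDiffAt_inner_covField_ν (hu : u ∈ O) (v x : Eu k) :
    ContDiffAt ℝ ∞ (fun t => g (f t) (covField Γ f ν t v) (fderiv ℝ f t x)) u := by
  have hU := S.isOpen.mem_nhds (M.maps u hu)
  have h1 := contDiffAt_covField (S.smooth_Γ.contDiffAt hU) (M.contDiffAt_f hu)
    (M.contDiffAt_ν hu) (contDiffAt_const (c := v))
  have h2 := contDiffAt_fderiv_apply (M.contDiffAt_f hu) (contDiffAt_const (c := x))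
  exact (((S.smooth_g.contDiffAt hU).comp u (M.contDiffAt_f hu)).clm_apply h1).clm_apply h2

lemma contDiffAt_gram_inv (hinj : ∀ t ∈ O, Function.Injective (fderiv ℝ f t)) (hu : u ∈ O)
    (i j : Fin k) :
    ContDiffAt ℝ ∞ (fun t => (gram fun v x => inducedForm g f t v x)⁻¹ i j) u := by
  refine (contDiffOn_matrix_inv (s := O) (fun i j => ?_) (fun t ht =>
    isUnit_det_inducedForm S M (hinj t ht) ht) i j).contDiffAt (M.isOpen.mem_nhds hu)
  exact ((contDiffOn_inducedForm M.isOpen M.smooth_f M.maps S.smooth_g).clm_apply contDiffOn_const).clm_apply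
    contDiffOn_const

lemma contDiffAt_traceNu (hinj : ∀ t ∈ O, Function.Injective (fderiv ℝ f t)) (hu : u ∈ O) :
    ContDiffAt ℝ ∞ (traceNu g Γ f ν) u :=
  ContDiffAt.sum fun i _ => ContDiffAt.sum fun j _ =>
    (contDiffAt_gram_inv S M hinj hu i j).mul (contDiffAt_inner_covField_ν S M hu _ _)

/-- The mean curvature is constant along `ξ`. -/
lemma fderiv_traceNu_w (hinj : ∀ t ∈ O, Function.Injective (fderiv ℝ f t)) (hu : u ∈ O) :
    fderiv ℝ (traceNu g Γ f ν) u (w u) = 0 := by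
  have dI := fun i j => (contDiffAt_gram_inv S M hinj hu i j).differentiableAt (by simp)
  have da := fun v x => (contDiffAt_inner_covField_ν S M hu v x).differentiableAt (by simp)
  have dG : ∀ v x, DifferentiableAt ℝ (fun t => inducedForm g f t v x) u := fun v x =>
    ((((contDiffOn_inducedForm M.isOpen M.smooth_f M.maps S.smooth_g).clm_apply contDiffOn_const).clm_apply
      contDiffOn_const).contDiffAt (M.isOpen.mem_nhds hu)).differentiableAt (by simp)
  let I : Matrix (Fin k) (Fin k) ℝ := (gram fun v x => inducedForm g f u v x)⁻¹
  let G : Matrix (Fin k) (Fin k) ℝ := gram fun v x => inducedForm g f u v x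
  let I' : Matrix (Fin k) (Fin k) ℝ := Matrix.of fun i j =>
    fderiv ℝ (fun t => (gram fun v x => inducedForm g f t v x)⁻¹ i j) u (w u)
  let G' : Matrix (Fin k) (Fin k) ℝ := Matrix.of fun i j =>
    fderiv ℝ (fun t => inducedForm g f t (e i) (e j)) u (w u)
  let a : Matrix (Fin k) (Fin k) ℝ := Matrix.of fun i j =>
    g (f u) (covField Γ f ν u (e i)) (fderiv ℝ f u (e j))
  let a' : Matrix (Fin k) (Fin k) ℝ := Matrix.of fun i j =>
    fderiv ℝ (fun t => g (f t) (covField Γ f ν t (e i)) (fderiv ℝ f t (e j))) u (w u)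
  -- The Jacobian of the coordinate expression of `ξ`; it encodes the brackets of `ξ` with the
  -- coordinate fields, hence the Lie derivatives of `G` and `a`.
  let Q : Matrix (Fin k) (Fin k) ℝ := Matrix.of fun l i => fderiv ℝ w u (e i) l
  have hI : I * G = 1 := Matrix.nonsing_inv_mul _ (isUnit_det_inducedForm S M (hinj u hu) hu)
  have h' : I' * G + I * G' = 0 := by
    ext i l
    have hc : (fun t => ∑ j, (gram fun v x => inducedForm g f t v x)⁻¹ i j
        * inducedForm g f t (e j) (e l)) =ᶠ[nhds u] fun _ => (1 : Matrix (Fin k) (Fin k) ℝ) i l := by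
      filter_upwards [M.isOpen.mem_nhds hu] with t ht
      rw [← Matrix.nonsing_inv_mul _ (isUnit_det_inducedForm S M (hinj t ht) ht),
        Matrix.mul_apply]
      rfl
    have h0 : fderiv ℝ (fun t => ∑ j, (gram fun v x => inducedForm g f t v x)⁻¹ i j
        * inducedForm g f t (e j) (e l)) u (w u) = 0 := by
      rw [hc.fderiv_eq]; simp
    have hs : HasFDerivAt (fun t => ∑ j, (gram fun v x => inducedForm g f t v x)⁻¹ i j
        * inducedForm g f t (e j) (e l)) _ u := HasFDerivAt.fun_sum (u := Finset.univ) fun j _ =>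
      (dI i j).hasFDerivAt.mul (dG (e j) (e l)).hasFDerivAt
    rw [hs.fderiv] at h0
    simp only [Matrix.add_apply, Matrix.mul_apply, Matrix.zero_apply]
    rw [← h0, _root_.sum_apply, ← Finset.sum_add_distrib]
    refine Finset.sum_congr rfl fun j _ => ?_
    simp [I', I, G', G, gram]; ring
  have hQ : ∀ i, fderiv ℝ w u (e i) = ∑ l, Q l i • (e l : Eu k) := fun i => eq_sum_smul_e _
  have hG : G' = -(Q.transpose * G) - G * Q := by
    ext i j
    have := fderiv_inner_fderiv S M hu (e i) (e j)
    have h2 : G' i j = _ := this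
    rw [h2, hQ i, hQ j]
    simp [Matrix.mul_apply, G, gram, inducedForm_apply, mul_comm]
  have ha : a' = -(Q.transpose * a) - a * Q := by
    ext i j
    have := fderiv_inner_covField_ν S M hu (e i) (e j)
    have h2 : a' i j = _ := this
    have h3 : covField Γ f ν u (fderiv ℝ w u (e i)) = ∑ l, Q l i • covField Γ f ν u (e l) := by
      have hl := clm_apply_eq_sum (fderiv ℝ ν u + ((Γ (f u)).flip (ν u)).comp (fderiv ℝ f u))
        (fderiv ℝ w u (e i))
      simpa [covField, Q] using hl
    rw [h2, h3, hQ j]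
    simp [Matrix.mul_apply, a, mul_comm]
  have key := sum_deriv_trace_eq_zero hI h' hG ha
  have hs : HasFDerivAt (traceNu g Γ f ν) _ u := HasFDerivAt.fun_sum (u := Finset.univ) fun i _ =>
    HasFDerivAt.fun_sum (u := Finset.univ) fun j _ =>
      (dI i j).hasFDerivAt.mul (da (e i) (e j)).hasFDerivAt
  rw [hs.fderiv, ← key, _root_.sum_apply]
  refine Finset.sum_congr rfl fun i _ => ?_
  rw [_root_.sum_apply]
  refine Finset.sum_congr rfl fun j _ => ?_
  simp [I', I, a, a']; ring

end ContactHypersurface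

/-! ### The deformed connection and the `ξ`-component of the biharmonic equation. -/

namespace SasakianChart

section

variable {E X : Type*} [NormedAddCommGroup E] [NormedSpace ℝ E]
  [NormedAddCommGroup X] [NormedSpace ℝ X]
  {U : Set E} {g : E → E →L[ℝ] E →L[ℝ] ℝ} {Γ Γs : E → E →L[ℝ] E →L[ℝ] E}
  {φ : E → E →L[ℝ] E} {ξ : E → E} (S : SasakianChart U g Γ φ ξ) {κ : ℝ}
  (hs : ∀ y ∈ U, ∀ v w, Γs y v w = Γ y v w - κ • (g y (ξ y) v • φ y w + g y (ξ y) w • φ y v))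
  {f Z : X → E} {u : X}

include S hs

omit S in
lemma covField_deformed (hu : f u ∈ U) (v : X) :
    covField Γs f Z u v = covField Γ f Z u v - κ • (g (f u) (ξ (f u)) (fderiv ℝ f u v) • φ (f u) (Z u)
      + g (f u) (ξ (f u)) (Z u) • φ (f u) (fderiv ℝ f u v)) := by
  rw [covField, covField, hs _ hu]; abel

/-- The `ξ`-component of the covariant derivative for the deformed connection. -/
lemma η_covField_deformed (hu : f u ∈ U) (hf : DifferentiableAt ℝ f u)
    (hZ : DifferentiableAt ℝ Z u) (v : X) :
    g (f u) (ξ (f u)) (covField Γs f Z u v)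
      = fderiv ℝ (fun t => g (f t) (ξ (f t)) (Z t)) u v
        + g (f u) (Z u) (φ (f u) (fderiv ℝ f u v)) := by
  have dx := (S.smooth_ξ.contDiffAt (S.isOpen.mem_nhds hu)).differentiableAt (by simp)
  -- Differentiate `g(ξ, Z)` with the undeformed connection; the deformation takes values in the
  -- image of `φ`, which is orthogonal to `ξ`.
  have h := S.fderiv_inner hu hf (hasFDerivAt_along dx hf).differentiableAt hZ v
  rw [S.covField_ξ hu hf] at h
  rw [covField_deformed hs hu, h, S.symm _ hu (Z u)]
  simp [S.η_φ hu]

/-- The `ξ`-component of the curvature of the deformed connection. -/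
lemma η_curv_deformed (hΓs : ContDiffOn ℝ ∞ Γs U) {y : E} (hy : y ∈ U) (u v w : E) :
    g y (ξ y) (curv Γs y u v w)
      = (1 + κ) * (g y (ξ y) u * g y v w - g y (ξ y) v * g y u w) := by
  have dg : ∀ z ∈ U, DifferentiableAt ℝ g z := fun z hz =>
    (S.smooth_g.contDiffAt (S.isOpen.mem_nhds hz)).differentiableAt (by simp)
  have dφ : ∀ z ∈ U, DifferentiableAt ℝ φ z := fun z hz =>
    (S.smooth_φ.contDiffAt (S.isOpen.mem_nhds hz)).differentiableAt (by simp)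
  have hp : ContDiffAt ℝ ∞ (fun z => g z (ξ z) w) y :=
    ((S.smooth_g.clm_apply S.smooth_ξ).clm_apply contDiffOn_const).contDiffAt
      (S.isOpen.mem_nhds hy)
  have dp := differentiableAt_fderiv hp
  have dΓ : DifferentiableAt ℝ Γs y :=
    (hΓs.contDiffAt (S.isOpen.mem_nhds hy)).differentiableAt (by simp)
  have dΓa : ∀ a, DifferentiableAt ℝ (fun z => Γs z a w) y := fun a =>
    (dΓ.clm_apply (differentiableAt_const a)).clm_apply (differentiableAt_const w)
  -- The curvature is a commutator of covariant derivatives along the identity map, with `z ↦ Γs z v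
  -- w` as the field `∇*_v w`. The formula for `η(∇* ·)` then applies once to each derivative.
  have hcurv : curv Γs y u v w = covField Γs (fun z => z) (fun z => Γs z v w) y u
      - covField Γs (fun z => z) (fun z => Γs z u w) y v := by
    have hd : ∀ a b, fderiv ℝ (fun z => Γs z a w) y b = fderiv ℝ Γs y b a w := by
      intro a b
      have := fderiv_bilin_along (B := Γs) (f := fun z : E => z) dΓ differentiableAt_id
        (differentiableAt_const a) (differentiableAt_const w) b
      simpa using this
    simp [covField, curv, hd]
  have h1 : ∀ a, ∀ z ∈ U, g z (ξ z) (Γs z a w)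
      = fderiv ℝ (fun z => g z (ξ z) w) z a + g z w (φ z a) := by
    intro a z hz
    have := S.η_covField_deformed hs (f := fun z : E => z) (Z := fun _ => w) hz differentiableAt_id
      (differentiableAt_const w) a
    simpa [covField] using this
  -- On antisymmetrizing in `a`, `b`, the second derivative of `η(w)` and the torsion-free terms
  -- cancel. The constant `1` in `1 + κ` comes from the derivative of `φ`, and `κ` from the
  -- deformation inside the last term.
  have h2 : ∀ a b, g y (ξ y) (covField Γs (fun z => z) (fun z => Γs z a w) y b)
      = fderiv ℝ (fderiv ℝ (fun z => g z (ξ z) w)) y b a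
        + (g y (Γ y b w) (φ y a) + g y w (φ y (Γ y b a) + g y b a • ξ y - g y (ξ y) a • b))
        + g y (Γs y a w) (φ y b) := by
    intro a b
    rw [S.η_covField_deformed hs (f := fun z : E => z) hy differentiableAt_id (dΓa a)]
    have hev : (fun z => g z (ξ z) (Γs z a w)) =ᶠ[nhds y] fun z =>
        fderiv ℝ (fun z => g z (ξ z) w) z a + g z w (φ z a) := by
      filter_upwards [S.isOpen.mem_nhds hy] with z hz using h1 a z hz
    have dφa : DifferentiableAt ℝ (fun z => φ z a) y :=
      (dφ y hy).clm_apply (differentiableAt_const a)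
    have d1 : DifferentiableAt ℝ (fun z => fderiv ℝ (fun z => g z (ξ z) w) z a) y :=
      dp.clm_apply (differentiableAt_const a)
    have d2 : DifferentiableAt ℝ (fun z => g z w (φ z a)) y :=
      ((dg y hy).clm_apply (differentiableAt_const w)).clm_apply dφa
    have e1 := S.fderiv_inner (f := fun z : E => z) hy differentiableAt_id
      (differentiableAt_const w) dφa b
    have e2 := S.covField_φ (f := fun z : E => z) (Z := fun _ => a) hy differentiableAt_id
      (differentiableAt_const a) b
    rw [e2] at e1
    rw [hev.fderiv_eq, fderiv_fun_add d1 d2, _root_.add_apply, e1,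
      fderiv_fderiv_apply dp (differentiableAt_const a)]
    simp [covField]
  rw [hcurv, map_sub, h2, h2, fderiv_fderiv_symm hp u v, hs y hy, hs y hy,
    S.torsion y hy u v, S.symm y hy v u]
  have hφφ : ∀ a b, g y (φ y a) (φ y b) = g y a b - g y (ξ y) a * g y (ξ y) b := by
    intro a b
    rw [S.skew y hy, S.φ_sq y hy]
    simp [S.symm y hy a (ξ y)]; ring
  simp only [map_sub, map_add, map_smul, _root_.sub_apply, _root_.add_apply, _root_.smul_apply,
    smul_eq_mul, hφφ]
  rw [S.symm y hy w u, S.symm y hy w v, S.symm y hy v u, S.symm y hy w (ξ y)]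
  ring

end

end SasakianChart

namespace ContactHypersurface

variable {n k : ℕ} {U : Set (Eu n)} {g : Eu n → Eu n →L[ℝ] Eu n →L[ℝ] ℝ}
  {Γ Γs : Eu n → Eu n →L[ℝ] Eu n →L[ℝ] Eu n}
  {φ : Eu n → Eu n →L[ℝ] Eu n} {ξ : Eu n → Eu n} (S : SasakianChart U g Γ φ ξ) {κ : ℝ}
  (hs : ∀ y ∈ U, ∀ v w, Γs y v w = Γ y v w - κ • (g y (ξ y) v • φ y w + g y (ξ y) w • φ y v))
  (hΓs : ContDiffOn ℝ ∞ Γs U)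
  {O : Set (Eu k)} {f ν : Eu k → Eu n} {w : Eu k → Eu k}
  (M : ContactHypersurface U g ξ O f ν w) {u : Eu k} {h : Eu k → ℝ}

include S M

/-- The `ξ`-component of the second covariant derivative of a normal field. -/
lemma η_secondCov (hs : ∀ y ∈ U, ∀ v w,
      Γs y v w = Γ y v w - κ • (g y (ξ y) v • φ y w + g y (ξ y) w • φ y v))
    (hΓs : ContDiffOn ℝ ∞ Γs U) (hinj : Function.Injective (fderiv ℝ f u)) (hu : u ∈ O)
    (hh : ContDiffOn ℝ ∞ h O) (v x : Eu k) :
    g (f u) (ξ (f u)) (covField Γs f (fun t => covField Γs f (fun t => h t • ν t) t x) u v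
        - covField Γs f (fun t => h t • ν t) u
          (christoffel (induced (fun y a b => g y a b) f) u v x))
      = g (f u) (covField Γ f (fun t => h t • ν t) u v) (φ (f u) (fderiv ℝ f u x))
        + g (f u) (covField Γ f (fun t => h t • ν t) u x) (φ (f u) (fderiv ℝ f u v)) := by
  have hU := M.maps u hu
  have df := M.differentiableAt_f hu
  have hH : ∀ t ∈ O, ContDiffAt ℝ ∞ (fun t => h t • ν t) t := fun t ht =>
    (hh.contDiffAt (M.isOpen.mem_nhds ht)).smul (M.contDiffAt_ν ht)
  have dH : ∀ t ∈ O, DifferentiableAt ℝ (fun t => h t • ν t) t := fun t ht =>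
    (hH t ht).differentiableAt (by simp)
  have dT : DifferentiableAt ℝ (fun t => covField Γs f (fun t => h t • ν t) t x) u :=
    (contDiffAt_covField (hΓs.contDiffAt (S.isOpen.mem_nhds hU)) (M.contDiffAt_f hu) (hH u hu)
      (contDiffAt_const (c := x))).differentiableAt (by simp)
  have hηH : ∀ t ∈ O, g (f t) (ξ (f t)) (h t • ν t) = 0 := fun t ht => by
    rw [map_smul, S.symm _ (M.maps t ht), M.normal_ξ ht, smul_zero]
  have hT : ∀ a, ∀ t ∈ O, g (f t) (ξ (f t)) (covField Γs f (fun t => h t • ν t) t a)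
      = g (f t) (h t • ν t) (φ (f t) (fderiv ℝ f t a)) := by
    intro a t ht
    rw [S.η_covField_deformed hs (M.maps t ht) (M.differentiableAt_f ht) (dH t ht)]
    have : (fun t => g (f t) (ξ (f t)) (h t • ν t)) =ᶠ[nhds t] fun _ => 0 := by
      filter_upwards [M.isOpen.mem_nhds ht] with s hs using hηH s hs
    rw [this.fderiv_eq]; simp
  have hev : (fun t => g (f t) (ξ (f t)) (covField Γs f (fun t => h t • ν t) t x)) =ᶠ[nhds u]
      fun t => g (f t) (h t • ν t) (φ (f t) (fderiv ℝ f t x)) := by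
    filter_upwards [M.isOpen.mem_nhds hu] with s hs using hT x s hs
  have dφ := (S.smooth_φ.contDiffAt (S.isOpen.mem_nhds hU)).differentiableAt (by simp)
  have dfx := M.differentiableAt_fderiv_f hu x
  rw [map_sub, hT _ u hu, S.η_covField_deformed hs hU df dT, hev.fderiv_eq,
    S.fderiv_inner hU df (dH u hu) ((hasFDerivAt_along dφ df).differentiableAt.clm_apply dfx),
    S.covField_φ hU df dfx, SasakianChart.covField_deformed hs hU, hηH u hu]
  -- By the Gauss formula `y` is the second fundamental form term, a multiple of `ν`; it disappears
  -- because `g(ν, φ ν) = 0`.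
  set y := covField Γ f (fun t => fderiv ℝ f t x) u v
    - fderiv ℝ f u (christoffel (induced (fun y a b => g y a b) f) u v x) with hy
  have hy1 : y = g (f u) y (ν u) • ν u := by
    refine exists_smul_normal M hu fun z => ?_
    rw [hy, map_sub, _root_.sub_apply, inner_christoffel_induced S M hinj hu, sub_self]
  have hy2 : g (f u) (h u • ν u) (φ (f u) y) = 0 := by
    rw [hy1, map_smul, map_smul, map_smul, _root_.smul_apply, S.symm _ hU (ν u),
      S.g_φ_self hU, smul_zero, smul_zero]
  have hy3 : g (f u) (h u • ν u) (φ (f u) (covField Γ f (fun t => fderiv ℝ f t x) u v))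
      = g (f u) (h u • ν u) (φ (f u)
        (fderiv ℝ f u (christoffel (induced (fun y a b => g y a b) f) u v x))) := by
    rw [← sub_eq_zero, ← map_sub, ← map_sub, ← hy, hy2]
  -- This orthogonality removes the remaining occurrence of `κ`.
  have hφφ : g (f u) (φ (f u) (ν u)) (φ (f u) (fderiv ℝ f u v)) = 0 := by
    rw [S.skew _ hU, S.φ_sq _ hU]
    simp [M.normal u hu, M.normal_ξ hu]
  simp only [map_sub, map_add, _root_.sub_apply] at hy3 ⊢
  rw [hy3]
  simp [hφφ, M.normal u hu, M.normal_ξ hu]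
  ring

/-- The trace pairs the self-adjoint shape operator with the skew form `g(·, φ ·)` on tangent
vectors, so it is zero. -/
lemma sum_inner_covField_ν_φ (hinj : Function.Injective (fderiv ℝ f u)) (hu : u ∈ O) :
    ∑ i, ∑ j, (gram fun v x => inducedForm g f u v x)⁻¹ i j
      * g (f u) (covField Γ f ν u (e i)) (φ (f u) (fderiv ℝ f u (e j))) = 0 := by
  have hU := M.maps u hu
  choose a ha using fun i : Fin k =>
    exists_tangent S M hinj hu (inner_covField_ν_ν S M hu (e i))
  let A : Matrix (Fin k) (Fin k) ℝ := Matrix.of fun m i => a i m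
  let G : Matrix (Fin k) (Fin k) ℝ := gram fun v x => inducedForm g f u v x
  let Ω : Matrix (Fin k) (Fin k) ℝ := Matrix.of fun m j =>
    g (f u) (fderiv ℝ f u (e m)) (φ (f u) (fderiv ℝ f u (e j)))
  have hunit := isUnit_det_inducedForm S M hinj hu
  have hG : G.transpose = G := gram_transpose _ (inducedForm_symm S M hu)
  have hGI : G * G⁻¹ = 1 := Matrix.mul_nonsing_inv _ hunit
  have hIG : G⁻¹ * G = 1 := Matrix.nonsing_inv_mul _ hunit
  have hIt : G⁻¹.transpose = G⁻¹ := by rw [Matrix.transpose_nonsing_inv, hG]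
  have hcov : ∀ i, covField Γ f ν u (e i) = ∑ m, A m i • fderiv ℝ f u (e m) := fun i => by
    rw [← ha i]; exact clm_apply_eq_sum _ _
  have hB : A.transpose * G = G * A := by
    have : (A.transpose * G).transpose = A.transpose * G := by
      have e1 : ∀ i l, (A.transpose * G) i l
          = g (f u) (covField Γ f ν u (e i)) (fderiv ℝ f u (e l)) := by
        intro i l
        rw [hcov]
        simp [Matrix.mul_apply, G, gram, inducedForm_apply]
      ext i l
      rw [Matrix.transpose_apply, e1, e1, inner_covField_ν_symm S M hu]
    rw [← this, Matrix.transpose_mul, hG, Matrix.transpose_transpose]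
  -- Self-adjointness of the shape operator, with its second index raised by the metric.
  have hAI : (A * G⁻¹).transpose = A * G⁻¹ := by
    rw [Matrix.transpose_mul, hIt]
    calc G⁻¹ * A.transpose = G⁻¹ * (A.transpose * G) * G⁻¹ := by
          rw [mul_assoc, mul_assoc, hGI, mul_one]
      _ = A * G⁻¹ := by rw [hB, ← mul_assoc, hIG, one_mul]
  have key := sum_symm_mul_antisymm (A * G⁻¹) Ω
    (fun i j => (congrFun (congrFun hAI i) j).symm)
    (fun i j => by
      simp only [Ω, Matrix.of_apply]
      rw [S.symm _ hU, S.skew _ hU])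
  rw [← key]
  have e2 : ∀ i j, g (f u) (covField Γ f ν u (e i)) (φ (f u) (fderiv ℝ f u (e j)))
      = ∑ m, A m i * Ω m j := by
    intro i j
    rw [hcov]; simp [Ω]
  simp only [e2, Matrix.mul_apply, Finset.mul_sum, Finset.sum_mul]
  rw [Finset.sum_congr rfl fun i _ => Finset.sum_comm, Finset.sum_comm]
  refine Finset.sum_congr rfl fun m _ => ?_
  rw [Finset.sum_comm]
  refine Finset.sum_congr rfl fun j _ => Finset.sum_congr rfl fun i _ => ?_
  ring

/-- The trace of the `ξ`-component of the second covariant derivative of a normal field. -/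
lemma η_trace_secondCov (hs : ∀ y ∈ U, ∀ v w,
      Γs y v w = Γ y v w - κ • (g y (ξ y) v • φ y w + g y (ξ y) w • φ y v))
    (hΓs : ContDiffOn ℝ ∞ Γs U) (hinj : Function.Injective (fderiv ℝ f u)) (hu : u ∈ O)
    (hh : ContDiffOn ℝ ∞ h O) {v₀ : Eu k} (hv₀ : fderiv ℝ f u v₀ = -φ (f u) (ν u)) :
    g (f u) (ξ (f u)) (traceWrt (induced (fun y a b => g y a b) f u) fun v x =>
        covField Γs f (fun t => covField Γs f (fun t => h t • ν t) t x) u v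
        - covField Γs f (fun t => h t • ν t) u
          (christoffel (induced (fun y a b => g y a b) f) u v x))
      = 2 * fderiv ℝ h u v₀ := by
  have hU := M.maps u hu
  have dh : DifferentiableAt ℝ h u :=
    (hh.contDiffAt (M.isOpen.mem_nhds hu)).differentiableAt (by simp)
  let I : Matrix (Fin k) (Fin k) ℝ := (gram fun v x => inducedForm g f u v x)⁻¹
  have hI : ∀ i j, I i j = I j i := gram_inv_symm _ (inducedForm_symm S M hu)
  let T : Fin k → Fin k → ℝ := fun i j =>
    g (f u) (covField Γ f (fun t => h t • ν t) u (e i)) (φ (f u) (fderiv ℝ f u (e j)))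
  have e1 : g (f u) (ξ (f u)) (traceWrt (induced (fun y a b => g y a b) f u) fun v x =>
        covField Γs f (fun t => covField Γs f (fun t => h t • ν t) t x) u v
        - covField Γs f (fun t => h t • ν t) u
          (christoffel (induced (fun y a b => g y a b) f) u v x))
      = ∑ i, ∑ j, I i j * (T i j + T j i) := by
    simp only [traceWrt, map_sum, map_smul, smul_eq_mul]
    refine Finset.sum_congr rfl fun i _ => Finset.sum_congr rfl fun j _ => ?_
    rw [η_secondCov S M hs hΓs hinj hu hh]
    rfl
  have e2 : ∑ i, ∑ j, I i j * (T i j + T j i) = 2 * ∑ i, ∑ j, I i j * T i j := by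
    simp only [mul_add, Finset.sum_add_distrib]
    have : ∑ i, ∑ j, I i j * T j i = ∑ i, ∑ j, I i j * T i j := by
      rw [Finset.sum_comm]
      exact Finset.sum_congr rfl fun i _ => Finset.sum_congr rfl fun j _ => by rw [hI j i]
    rw [this]; ring
  -- From `∇(h ν) = dh ν + h ∇ν`; skewness turns `g(ν, φ x)` into `g(-φ ν, x)`, the pairing with
  -- `V`. Contracting this first part gives `dh(V)`, and the second part has zero trace.
  have e3 : ∀ i j, T i j = fderiv ℝ h u (e i) * inducedForm g f u v₀ (e j)
      + h u * g (f u) (covField Γ f ν u (e i)) (φ (f u) (fderiv ℝ f u (e j))) := by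
    intro i j
    simp only [T]
    rw [covField_smul dh (M.differentiableAt_ν hu), inducedForm_apply, hv₀]
    have := S.skew _ hU (ν u) (fderiv ℝ f u (e j))
    simp [this]
  have hinv : ∀ i, ∑ j, I i j * inducedForm g f u v₀ (e j) = v₀ i := by
    intro i
    have hl : ∀ j, inducedForm g f u v₀ (e j) = ∑ m, v₀ m * inducedForm g f u (e m) (e j) := by
      intro j
      have := congrArg (fun L : Eu k →L[ℝ] ℝ => L (e j)) (clm_apply_eq_sum (inducedForm g f u) v₀)
      simpa [_root_.sum_apply] using this
    have hIG : I * (gram fun v x => inducedForm g f u v x) = 1 :=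
      Matrix.nonsing_inv_mul _ (isUnit_det_inducedForm S M hinj hu)
    simp only [hl, Finset.mul_sum]
    rw [Finset.sum_comm]
    calc ∑ m, ∑ j, I i j * (v₀ m * inducedForm g f u (e m) (e j))
        = ∑ m, v₀ m * (I * (gram fun v x => inducedForm g f u v x)) i m := by
          refine Finset.sum_congr rfl fun m _ => ?_
          rw [Matrix.mul_apply, Finset.mul_sum]
          refine Finset.sum_congr rfl fun j _ => ?_
          rw [inducedForm_symm S M hu]; simp [gram]; ring
      _ = v₀ i := by simp [hIG, Matrix.one_apply]
  rw [e1, e2]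
  congr 1
  have hz := sum_inner_covField_ν_φ S M hinj hu
  have e4 : ∑ i, ∑ j, I i j * T i j
      = ∑ i, fderiv ℝ h u (e i) * ∑ j, I i j * inducedForm g f u v₀ (e j)
        + h u * ∑ i, ∑ j, I i j
          * g (f u) (covField Γ f ν u (e i)) (φ (f u) (fderiv ℝ f u (e j))) := by
    simp only [e3, Finset.mul_sum, ← Finset.sum_add_distrib]
    exact Finset.sum_congr rfl fun i _ => Finset.sum_congr rfl fun j _ => by ring
  rw [e4, hz, clm_apply_eq_sum (fderiv ℝ h u) v₀]
  simp only [hinv, smul_eq_mul, mul_zero, add_zero]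
  exact Finset.sum_congr rfl fun i _ => mul_comm _ _

end ContactHypersurface

/-! ### The Ricci tensor of a Sasakian space form and its Levi-Civita connection. -/

namespace Coord

variable {n k : ℕ} {U : Set (Eu n)}

lemma sum_clm_mul (L : Eu n →L[ℝ] ℝ) (v : Eu n) : ∑ i, L (e i) * v i = L v := by
  rw [clm_apply_eq_sum L v]
  exact Finset.sum_congr rfl fun i _ => mul_comm _ _

/-- A skew-symmetric endomorphism has trace zero. -/
lemma sum_skew_apply (b : Eu n →L[ℝ] Eu n →L[ℝ] ℝ) (hs : ∀ v w, b v w = b w v)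
    (hu : IsUnit (gram fun v w => b v w).det) (φ : Eu n →L[ℝ] Eu n)
    (hφ : ∀ v w, b (φ v) w = -b v (φ w)) : ∑ i, φ (e i) i = 0 := by
  let Ω : Matrix (Fin n) (Fin n) ℝ := Matrix.of fun i j => b (φ (e i)) (e j)
  rw [← sum_symm_mul_antisymm (gram fun v w => b v w)⁻¹ Ω (gram_inv_symm _ hs)
    (fun i j => by simp only [Ω, Matrix.of_apply]; rw [hφ, hs])]
  refine Finset.sum_congr rfl fun i _ => ?_
  have hx : φ (e i) = WithLp.toLp 2 fun l => ∑ j, (gram fun v w => b v w)⁻¹ l j *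
      b (φ (e i)) (e j) :=
    eq_of_inner_eq b hu fun j => (inner_toLp_gram_inv b hs hu (b (φ (e i))) (e j)).symm
  conv_lhs => rw [hx]
  rfl

lemma christoffel_congr {G G' : Eu n → Eu n → Eu n → ℝ} (hU : IsOpen U)
    (h : ∀ z ∈ U, ∀ v w, G z v w = G' z v w) {y : Eu n} (hy : y ∈ U) (v w : Eu n) :
    christoffel G y v w = christoffel G' y v w := by
  have hd : ∀ a b, fderiv ℝ (fun z => G z a b) y = fderiv ℝ (fun z => G' z a b) y := by
    intro a b
    apply Filter.EventuallyEq.fderiv_eq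
    filter_upwards [hU.mem_nhds hy] with z hz using h z hz a b
  have hg : gram (G y) = gram (G' y) := by ext i j; exact h y hy _ _
  simp only [christoffel, hd, hg]

lemma riemann_eq_curv {G : Eu n → Eu n → Eu n → ℝ} {Γ : Eu n → Eu n →L[ℝ] Eu n →L[ℝ] Eu n}
    (hU : IsOpen U) (hΓ : ContDiffOn ℝ ∞ Γ U)
    (h : ∀ y ∈ U, ∀ v w, christoffel G y v w = Γ y v w) {y : Eu n} (hy : y ∈ U) (u v w : Eu n) :
    riemann G y u v w = curv Γ y u v w := by
  have dΓ : DifferentiableAt ℝ Γ y := (hΓ.contDiffAt (hU.mem_nhds hy)).differentiableAt (by simp)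
  have hd : ∀ a b, fderiv ℝ (fun z => christoffel G z a w) y b = fderiv ℝ Γ y b a w := by
    intro a b
    have he : (fun z => christoffel G z a w) =ᶠ[nhds y] fun z => Γ z a w := by
      filter_upwards [hU.mem_nhds hy] with z hz using h z hz a w
    rw [he.fderiv_eq, fderiv_bilin dΓ]
  simp only [riemann, cov, curv, hd, h y hy]

end Coord

section Chart

variable {n : ℕ} {U : Set (Eu n)} {g : Eu n → Eu n →L[ℝ] Eu n →L[ℝ] ℝ}
  {φ : Eu n → Eu n →L[ℝ] Eu n} {ξ : Eu n → Eu n}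

/-- The defining identities of a Sasakian space form, in a chart. -/
structure SpaceFormChart (U : Set (Eu n)) (g : Eu n → Eu n →L[ℝ] Eu n →L[ℝ] ℝ)
    (φ : Eu n → Eu n →L[ℝ] Eu n) (ξ : Eu n → Eu n) (c : ℝ) : Prop where
  isOpen : IsOpen U
  smooth_g : ContDiffOn ℝ ∞ g U
  smooth_φ : ContDiffOn ℝ ∞ φ U
  smooth_ξ : ContDiffOn ℝ ∞ ξ U
  symm : ∀ y ∈ U, ∀ v w, g y v w = g y w v
  pos : ∀ y ∈ U, ∀ v, v ≠ 0 → 0 < g y v v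
  unit_ξ : ∀ y ∈ U, g y (ξ y) (ξ y) = 1
  φ_ξ : ∀ y ∈ U, φ y (ξ y) = 0
  φ_sq : ∀ y ∈ U, ∀ v, φ y (φ y v) = -v + g y (ξ y) v • ξ y
  g_φ : ∀ y ∈ U, ∀ v w, g y (φ y v) (φ y w) = g y v w - g y (ξ y) v * g y (ξ y) w
  cov_φ : ∀ y ∈ U, ∀ v w, cov (fun y a b => g y a b) (fun z => φ z w) y v
      - φ y (christoffel (fun y a b => g y a b) y v w) = g y v w • ξ y - g y w (ξ y) • v
  curvature : ∀ y ∈ U, ∀ u v w, riemann (fun y a b => g y a b) y u v w =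
    (-((c - 1) / 4)) •
        (g y (ξ y) w • (g y (ξ y) v • u - g y (ξ y) u • v)
          + (g y v w * g y (ξ y) u - g y u w * g y (ξ y) v) • ξ y
          + g y (φ y u) w • φ y v
          + (2 * g y (φ y u) v) • φ y w
          - g y (φ y v) w • φ y u)
      + ((c + 3) / 4) • (g y v w • u - g y u w • v)

namespace SpaceFormChart

variable {c : ℝ} (S : SpaceFormChart U g φ ξ c)

include S

lemma η_φ {y : Eu n} (hy : y ∈ U) (v : Eu n) : g y (ξ y) (φ y v) = 0 := by
  have h1 := S.φ_sq y hy (φ y v)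
  rw [S.φ_sq y hy v, map_add, map_neg, map_smul, S.φ_ξ y hy, smul_zero, add_zero] at h1
  have h2 : g y (ξ y) (φ y v) • ξ y = 0 := by simpa using h1
  have h3 := congrArg (g y (ξ y)) h2
  simpa [S.unit_ξ y hy] using h3

lemma skew {y : Eu n} (hy : y ∈ U) (v w : Eu n) : g y (φ y v) w = -g y v (φ y w) := by
  have h := S.g_φ y hy v (φ y w)
  rw [S.φ_sq y hy w, S.η_φ hy] at h
  have h2 : g y (φ y v) (ξ y) = 0 := by rw [S.symm y hy, S.η_φ hy]
  simp only [map_add, map_neg, map_smul, h2, smul_zero, add_zero, mul_zero, sub_zero] at h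
  linarith

lemma isUnit_gram {y : Eu n} (hy : y ∈ U) : IsUnit (gram fun v w => g y v w).det :=
  isUnit_det_gram_of_pos _ (S.pos y hy)

/-- Contract the curvature formula: the traces that occur are `n` for the identity, `0` for `φ`, and
evaluations of one-forms for the rank-one terms; `φ² = -1 + η ⊗ ξ` handles the rest. -/
lemma ricci_eq {y : Eu n} (hy : y ∈ U) (v w : Eu n) :
    ricci (fun y a b => g y a b) y v w
      = ((c - 1) / 2 + (c + 3) * (n - 1) / 4) * g y v w
        + (-((c - 1) * (n + 1) / 4)) * (g y (ξ y) v * g y (ξ y) w) := by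
  have s0 : ∑ i : Fin n, (e i : Eu n) i = n := by simp [e_apply]
  have s1 : ∀ x, ∑ i, g y (ξ y) (e i) * x i = g y (ξ y) x := fun x => sum_clm_mul (g y (ξ y)) x
  have s2 : ∀ a x, ∑ i, g y (e i) a * x i = g y x a := fun a x =>
    sum_clm_mul ((g y).flip a) x
  have s3 : ∀ a x, ∑ i, g y (φ y (e i)) a * x i = g y (φ y x) a := fun a x =>
    sum_clm_mul (((g y).flip a).comp (φ y)) x
  have s4 : ∑ i, φ y (e i) i = 0 := sum_skew_apply (g y) (S.symm y hy) (S.isUnit_gram hy) (φ y)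
    fun v w => S.skew hy v w
  have hi : ∀ i, riemann (fun y a b => g y a b) y (e i) v w i
      = -((c - 1) / 4) * (g y (ξ y) w * g y (ξ y) v * (e i : Eu n) i
          - g y (ξ y) w * (g y (ξ y) (e i) * v i)
          + (g y v w * (g y (ξ y) (e i) * ξ y i) - g y (ξ y) v * (g y (e i) w * ξ y i))
          + g y (φ y (e i)) w * φ y v i + 2 * (g y (φ y (e i)) v * φ y w i)
          - g y (φ y v) w * φ y (e i) i)
        + (c + 3) / 4 * (g y v w * (e i : Eu n) i - g y (e i) w * v i) := by
    intro i
    rw [S.curvature y hy]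
    simp only [PiLp.add_apply, PiLp.smul_apply, PiLp.sub_apply, smul_eq_mul]
    ring
  rw [ricci, Finset.sum_congr rfl fun i _ => hi i]
  simp only [Finset.sum_add_distrib, Finset.sum_sub_distrib, ← Finset.mul_sum, s0, s1, s2, s3, s4,
    S.φ_sq y hy, S.unit_ξ y hy]
  simp only [map_add, map_neg, map_smul, _root_.add_apply, _root_.neg_apply, _root_.smul_apply,
    smul_eq_mul]
  rw [S.symm y hy w v]
  ring

/-- The Levi-Civita connection. -/
lemma exists_sasakianChart : ∃ Γ : Eu n → Eu n →L[ℝ] Eu n →L[ℝ] Eu n,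
    SasakianChart U g Γ φ ξ ∧
      ∀ y ∈ U, ∀ v w, christoffel (fun y a b => g y a b) y v w = Γ y v w := by
  obtain ⟨Γ, hΓ, hc⟩ := exists_christoffel S.isOpen S.smooth_g fun y hy => S.isUnit_gram hy
  have dφ : ∀ y ∈ U, DifferentiableAt ℝ φ y := fun y hy =>
    (S.smooth_φ.contDiffAt (S.isOpen.mem_nhds hy)).differentiableAt (by simp)
  have dξ : ∀ y ∈ U, DifferentiableAt ℝ ξ y := fun y hy =>
    (S.smooth_ξ.contDiffAt (S.isOpen.mem_nhds hy)).differentiableAt (by simp)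
  have dg : ∀ y ∈ U, DifferentiableAt ℝ g y := fun y hy =>
    (S.smooth_g.contDiffAt (S.isOpen.mem_nhds hy)).differentiableAt (by simp)
  have hmetric : ∀ y ∈ U, ∀ x a b,
      fderiv ℝ g y x a b = g y (Γ y x a) b + g y a (Γ y x b) := by
    intro y hy x a b
    rw [fderiv_metric S.isOpen S.smooth_g S.symm hy (S.isUnit_gram hy), hc y hy, hc y hy]
  have hφ : ∀ y ∈ U, ∀ v w, fderiv ℝ φ y v w + Γ y v (φ y w) - φ y (Γ y v w)
      = g y v w • ξ y - g y (ξ y) w • v := by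
    intro y hy v w
    have h1 := S.cov_φ y hy v w
    have h2 := fderiv_linear_along (f := fun z : Eu n => z) (dφ y hy) differentiableAt_id
      (differentiableAt_const w) v
    rw [cov, h2, hc y hy, hc y hy, S.symm y hy w] at h1
    simpa using h1
  refine ⟨Γ, ⟨S.isOpen, S.smooth_g, hΓ, S.smooth_φ, S.smooth_ξ, S.symm, S.pos, S.unit_ξ, S.φ_ξ,
    S.φ_sq, fun y hy => S.skew hy, hmetric, ?_, ?_, hφ, ?_⟩, hc⟩
  · intro y hy a b
    rw [← hc y hy, ← hc y hy, christoffel_symm S.isOpen S.smooth_g S.symm hy]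
  · intro y hy v
    -- The derivative `p = ∇_v ξ` is found from its two parts: differentiating `φ ξ = 0` gives `φ p
    -- = v - η(v) ξ`, and differentiating `g(ξ, ξ) = 1` gives `η(p) = 0`. Applying `φ` once more
    -- yields `p = -φ v`.
    set p := fderiv ℝ ξ y v + Γ y v (ξ y) with hp
    have h1 : fderiv ℝ φ y v (ξ y) + φ y (fderiv ℝ ξ y v) = 0 := by
      have h := fderiv_linear_along (f := fun z : Eu n => z) (dφ y hy) differentiableAt_id
        (dξ y hy) v
      have h0 : (fun z => φ z (ξ z)) =ᶠ[nhds y] fun _ => 0 := by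
        filter_upwards [S.isOpen.mem_nhds hy] with z hz using S.φ_ξ z hz
      rw [h0.fderiv_eq] at h
      simpa using h.symm
    have h2 := hφ y hy v (ξ y)
    rw [S.φ_ξ y hy, map_zero, add_zero, S.unit_ξ y hy, one_smul, eq_neg_of_add_eq_zero_left h1] at h2
    have h3 : φ y p = v - g y v (ξ y) • ξ y := by
      rw [hp, map_add, ← neg_inj, neg_sub, ← h2]; abel
    have h4 : g y (ξ y) p = 0 := by
      have h := fderiv_inner_along (f := fun z : Eu n => z) (dg y hy) (hmetric y hy)
        differentiableAt_id (dξ y hy) (dξ y hy) v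
      have h0 : (fun z => g z (ξ z) (ξ z)) =ᶠ[nhds y] fun _ => 1 := by
        filter_upwards [S.isOpen.mem_nhds hy] with z hz using S.unit_ξ z hz
      rw [h0.fderiv_eq, S.symm y hy (covField _ _ _ _ _)] at h
      have hpp : covField Γ (fun z : Eu n => z) ξ y v = p := by simp [covField, hp]
      rw [hpp] at h
      simp at h; linarith
    have h5 := S.φ_sq y hy p
    rw [h3, h4, zero_smul, add_zero, map_sub, map_smul, S.φ_ξ y hy, smul_zero, sub_zero] at h5
    rw [h5, neg_neg]
  -- With `ξ` in the first slot the terms in `φ` vanish, and the rest has coefficient `(c + 3) / 4 -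
  -- (c - 1) / 4 = 1`, independent of `c`.
  · intro y hy v w
    rw [← riemann_eq_curv S.isOpen hΓ hc hy, S.curvature y hy, S.φ_ξ y hy, S.unit_ξ y hy]
    simp only [map_zero, _root_.zero_apply, zero_smul, mul_zero, smul_zero, sub_zero, add_zero]
    module

/-- The Levi-Civita connection of the Ricci tensor. -/
lemma exists_ricci_connection (hn : 2 ≤ n) (hU : U.Nonempty)
    (hric : ∀ y ∈ U, ∀ v : Eu n, v ≠ 0 → ∃ w : Eu n, ricci (fun y a b => g y a b) y v w ≠ 0)
    {Γ : Eu n → Eu n →L[ℝ] Eu n →L[ℝ] Eu n} (hΓ : SasakianChart U g Γ φ ξ) :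
    ∃ (κ : ℝ) (Γs : Eu n → Eu n →L[ℝ] Eu n →L[ℝ] Eu n), ContDiffOn ℝ ∞ Γs U ∧
      (∀ y ∈ U, ∀ v w, christoffel (ricci fun y a b => g y a b) y v w = Γs y v w) ∧
      ∀ y ∈ U, ∀ v w, Γs y v w = Γ y v w - κ • (g y (ξ y) v • φ y w + g y (ξ y) w • φ y v) := by
  set a : ℝ := (c - 1) / 2 + (c + 3) * (n - 1) / 4 with ha
  set b : ℝ := -((c - 1) * (n + 1) / 4) with hb
  -- If `a = 0`, the Ricci tensor is a multiple of `η ⊗ η`, degenerate on the kernel of `η`, which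
  -- is nonzero since `n ≥ 2`.
  have ha0 : a ≠ 0 := by
    intro h0
    obtain ⟨y, hy⟩ := hU
    have hker : LinearMap.ker (g y (ξ y)).toLinearMap ≠ ⊥ :=
      LinearMap.ker_ne_bot_of_finrank_lt (by simpa using by omega)
    obtain ⟨v, hv, hv0⟩ := Submodule.exists_mem_ne_zero_of_ne_bot hker
    obtain ⟨w, hw⟩ := hric y hy v hv0
    apply hw
    have hv' : g y (ξ y) v = 0 := hv
    rw [S.ricci_eq hy, ← ha, h0, hv']; ring
  let r : Eu n → Eu n →L[ℝ] Eu n →L[ℝ] ℝ := fun y =>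
    a • g y + b • (g y (ξ y)).smulRight (g y (ξ y))
  have hr : ∀ y v w, r y v w = a * g y v w + b * (g y (ξ y) v * g y (ξ y) w) := by
    intro y v w; simp [r]
  have hr1 : ∀ y ∈ U, ∀ v w, ricci (fun y a b => g y a b) y v w = r y v w := by
    intro y hy v w; rw [S.ricci_eq hy, hr]
  have hη : ∀ v, ContDiffOn ℝ ∞ (fun y => g y (ξ y) v) U := fun v =>
    (S.smooth_g.clm_apply S.smooth_ξ).clm_apply contDiffOn_const
  have hg' : ∀ v w, ContDiffOn ℝ ∞ (fun y => g y v w) U := fun v w =>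
    (S.smooth_g.clm_apply contDiffOn_const).clm_apply contDiffOn_const
  have hrs : ContDiffOn ℝ ∞ r U := by
    rw [contDiffOn_clm_apply_iff₂]
    intro v w
    simp only [hr]
    exact (contDiffOn_const.mul (hg' v w)).add (contDiffOn_const.mul ((hη v).mul (hη w)))
  have hrsymm : ∀ y ∈ U, ∀ v w, r y v w = r y w v := by
    intro y hy v w
    rw [hr, hr, S.symm y hy v w]; ring
  have hru : ∀ y ∈ U, IsUnit (gram fun v w => r y v w).det := fun y hy =>
    isUnit_det_gram _ fun v hv => by
      obtain ⟨w, hw⟩ := hric y hy v hv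
      exact ⟨w, by rwa [← hr1 y hy]⟩
  obtain ⟨Γs, hΓs, hc⟩ := exists_christoffel S.isOpen hrs hru
  refine ⟨b / a, Γs, hΓs, fun y hy v w => ?_, fun y hy v w => ?_⟩
  · rw [← hc y hy]
    exact christoffel_congr S.isOpen hr1 hy v w
  · rw [← hc y hy]
    have dr : DifferentiableAt ℝ r y :=
      (hrs.contDiffAt (S.isOpen.mem_nhds hy)).differentiableAt (by simp)
    refine christoffel_eq_of_inner dr (hrsymm y hy) (hru y hy) fun z => ?_
    have dξ : DifferentiableAt ℝ ξ y :=
      (S.smooth_ξ.contDiffAt (S.isOpen.mem_nhds hy)).differentiableAt (by simp)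
    have dη : ∀ p x, fderiv ℝ (fun z => g z (ξ z) p) y x
        = -g y p (φ y x) + g y (ξ y) (Γ y x p) := by
      intro p x
      have h1 := hΓ.fderiv_inner (f := fun z : Eu n => z) hy differentiableAt_id dξ
        (differentiableAt_const p) x
      have h2 := hΓ.covField_ξ (f := fun z : Eu n => z) hy differentiableAt_id x
      rw [h2] at h1
      rw [h1, S.symm y hy p]
      simp [covField]
    have dD : ∀ x p q, fderiv ℝ r y x p q = a * (g y (Γ y x p) q + g y p (Γ y x q))
        + b * ((-g y p (φ y x) + g y (ξ y) (Γ y x p)) * g y (ξ y) q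
          + g y (ξ y) p * (-g y q (φ y x) + g y (ξ y) (Γ y x q))) := by
      intro x p q
      have d1 : ∀ p, DifferentiableAt ℝ (fun z => g z (ξ z) p) y := fun p =>
        ((hη p).contDiffAt (S.isOpen.mem_nhds hy)).differentiableAt (by simp)
      have d2 : DifferentiableAt ℝ (fun z => g z p q) y :=
        ((hg' p q).contDiffAt (S.isOpen.mem_nhds hy)).differentiableAt (by simp)
      have d3 : DifferentiableAt ℝ g y :=
        (S.smooth_g.contDiffAt (S.isOpen.mem_nhds hy)).differentiableAt (by simp)
      rw [← fderiv_bilin dr]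
      simp only [hr]
      have h := (d2.hasFDerivAt.const_mul a).add
        (((d1 p).hasFDerivAt.mul (d1 q).hasFDerivAt).const_mul b)
      have h' := h.fderiv
      have h'' := congrArg (fun L : Eu n →L[ℝ] ℝ => L x) h'
      refine h''.trans ?_
      simp only [_root_.add_apply, _root_.smul_apply, smul_eq_mul, dη]
      rw [fderiv_bilin d3, hΓ.metric y hy]
      ring
    -- The derivatives of `a g` reproduce `a ∇`. Those of `b η ⊗ η` involve `∇η`, which is skew, and
    -- leave `-b (η(v) φ w + η(w) φ v)` paired with `z`; dividing by `a` gives `κ = b / a`.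
    rw [koszul_apply, dD, dD, dD, hr]
    have hk : b / a * a = b := div_mul_cancel₀ b ha0
    have t1 := hΓ.torsion y hy w v
    have t2 := hΓ.torsion y hy z v
    have t3 := hΓ.torsion y hy z w
    have e1 : g y v (φ y w) = -g y w (φ y v) := by rw [← S.skew hy, S.symm y hy]
    have e2 : g y v (φ y z) = -g y z (φ y v) := by rw [← S.skew hy, S.symm y hy]
    have e3 : g y w (φ y z) = -g y z (φ y w) := by rw [← S.skew hy, S.symm y hy]
    rw [t1, t2, t3, e1, e2, e3, S.symm y hy v (Γ y w z), S.symm y hy w (Γ y v z)]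
    simp only [map_sub, map_add, map_smul, _root_.sub_apply, _root_.add_apply, _root_.smul_apply,
      smul_eq_mul, S.η_φ hy, S.symm y hy (φ y _) z]
    have hk' : b = a * (b / a) := by rw [mul_comm, hk]
    generalize b / a = q at hk'
    rw [hk']
    ring

end SpaceFormChart

end Chart

/-! ### Immersed hypersurfaces in a chart. -/

section Local

open ContactHypersurface

variable {n k : ℕ} {U : Set (Eu n)} {g : Eu n → Eu n →L[ℝ] Eu n →L[ℝ] ℝ}
  {φ : Eu n → Eu n →L[ℝ] Eu n} {ξ : Eu n → Eu n} {c : ℝ}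
  {O : Set (Eu k)} {f : Eu k → Eu n}

/-- The trace of an endomorphism in terms of the associated bilinear form. -/
lemma trace_eq_sum_gram_inv (b : Eu k →L[ℝ] Eu k →L[ℝ] ℝ) (hs : ∀ v w, b v w = b w v)
    (hu : IsUnit (gram fun v w => b v w).det) (L : Eu k →ₗ[ℝ] Eu k) :
    LinearMap.trace ℝ (Eu k) L = ∑ i, ∑ j, (gram fun v w => b v w)⁻¹ i j * b (L (e i)) (e j) := by
  rw [LinearMap.trace_eq_matrix_trace ℝ (EuclideanSpace.basisFun (Fin k) ℝ).toBasis]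
  simp only [Matrix.trace, Matrix.diag_apply, LinearMap.toMatrix_apply]
  refine Finset.sum_congr rfl fun i _ => ?_
  have hx : L (e i) = WithLp.toLp 2 fun l => ∑ j, (gram fun v w => b v w)⁻¹ l j *
      b (L (e i)) (e j) :=
    eq_of_inner_eq b hu fun j => (inner_toLp_gram_inv b hs hu (b (L (e i))) (e j)).symm
  have h1 := congrArg (fun v : Eu k => v i) hx
  simpa [e] using h1

/-- The tangential part of a field along `f`. -/
def tangentPart (g : Eu n → Eu n →L[ℝ] Eu n →L[ℝ] ℝ) (f Z : Eu k → Eu n) (t : Eu k) : Eu k :=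
  WithLp.toLp 2 fun i => ∑ l, (gram fun v w => inducedForm g f t v w)⁻¹ i l
    * g (f t) (Z t) (fderiv ℝ f t (e l))

/-- An immersion of an open set of `ℝᵏ` into a Riemannian chart. -/
structure ImmersionChart (U : Set (Eu n)) (O : Set (Eu k)) (f : Eu k → Eu n) : Prop where
  isOpen : IsOpen O
  maps : ∀ t ∈ O, f t ∈ U
  smooth : ContDiffOn ℝ ∞ f O
  injective : ∀ t ∈ O, Function.Injective (fderiv ℝ f t)

namespace ImmersionChart

variable (F : ImmersionChart U O f) (S : SpaceFormChart U g φ ξ c)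

include F S

lemma isUnit_gram {t : Eu k} (ht : t ∈ O) :
    IsUnit (gram fun v w => inducedForm g f t v w).det :=
  isUnit_det_gram_of_pos _ fun _ hv => S.pos _ (F.maps t ht) _ fun h =>
    hv (F.injective t ht (h.trans (map_zero _).symm))

lemma inner_tangentPart {t : Eu k} (ht : t ∈ O) (Z : Eu k → Eu n) (v : Eu k) :
    g (f t) (fderiv ℝ f t (tangentPart g f Z t)) (fderiv ℝ f t v)
      = g (f t) (Z t) (fderiv ℝ f t v) :=
  inner_toLp_gram_inv (inducedForm g f t) (fun _ _ => S.symm _ (F.maps t ht) _ _)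
    (F.isUnit_gram S ht) ((g (f t) (Z t)).comp (fderiv ℝ f t)) v

lemma contDiffOn_tangentPart {Z : Eu k → Eu n} (hZ : ContDiffOn ℝ ∞ Z O) :
    ContDiffOn ℝ ∞ (tangentPart g f Z) O := by
  rw [contDiffOn_piLp]; intro i
  have hf' : ∀ v, ContDiffOn ℝ ∞ (fun t => fderiv ℝ f t v) O := fun v =>
    (F.smooth.fderiv_of_isOpen F.isOpen (by simp)).clm_apply contDiffOn_const
  simp only [tangentPart]
  refine ContDiffOn.sum fun l _ => ContDiffOn.mul ?_ ?_
  · refine contDiffOn_matrix_inv (fun a b => ?_) (fun t ht => F.isUnit_gram S ht) i l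
    exact ((contDiffOn_inducedForm F.isOpen F.smooth F.maps S.smooth_g).clm_apply
      contDiffOn_const).clm_apply contDiffOn_const
  · exact ((S.smooth_g.comp F.smooth F.maps).clm_apply hZ).clm_apply (hf' _)

/-- A dimension count: tangent space and normal line are independent and, as `n = k + 1`, fill the
ambient space. So `x` is orthogonal to itself. -/
lemma eq_zero_of_orthogonal (hn : n = k + 1) {t : Eu k} (ht : t ∈ O) {ν x : Eu n}
    (hν : g (f t) ν ν = 1) (hν' : ∀ v, g (f t) ν (fderiv ℝ f t v) = 0)
    (hx : ∀ v, g (f t) x (fderiv ℝ f t v) = 0) (hxν : g (f t) x ν = 0) : x = 0 := by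
  let L : (Eu k × ℝ) →ₗ[ℝ] Eu n :=
    (fderiv ℝ f t).toLinearMap.coprod (LinearMap.toSpanSingleton ℝ (Eu n) ν)
  have hL : ∀ v r, L (v, r) = fderiv ℝ f t v + r • ν := fun v r => by simp [L]
  have hinj : Function.Injective L := by
    rw [← LinearMap.ker_eq_bot, LinearMap.ker_eq_bot']
    rintro ⟨v, r⟩ h
    rw [hL] at h
    have h1 := congrArg (g (f t) ν) h
    have hr : r = 0 := by simpa [hν, hν'] using h1
    rw [hr, zero_smul, add_zero] at h
    have hv : v = 0 := F.injective t ht (h.trans (map_zero _).symm)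
    rw [hv, hr]; rfl
  have hsurj : Function.Surjective L :=
    (LinearMap.injective_iff_surjective_of_finrank_eq_finrank (by simp [hn])).1 hinj
  obtain ⟨⟨v, r⟩, hvr⟩ := hsurj x
  by_contra h0
  have hpos := S.pos _ (F.maps t ht) x h0
  have : g (f t) x x = 0 := by
    have h1 : g (f t) x (fderiv ℝ f t v + r • ν) = 0 := by
      rw [map_add, map_smul, hx, hxν]; simp
    rwa [← hL, hvr] at h1
  linarith

/-- A smooth unit normal near a given point. -/
lemma exists_normal {u : Eu k} (hu : u ∈ O) {N : Eu n}
    (hN : g (f u) N N = 1) (hN' : ∀ v, g (f u) N (fderiv ℝ f u v) = 0) :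
    ∃ (O' : Set (Eu k)) (ν : Eu k → Eu n), IsOpen O' ∧ O' ⊆ O ∧ u ∈ O' ∧ ContDiffOn ℝ ∞ ν O' ∧
      (∀ t ∈ O', g (f t) (ν t) (ν t) = 1) ∧ (∀ t ∈ O', ∀ v, g (f t) (ν t) (fderiv ℝ f t v) = 0) ∧
      ν u = N := by
  -- Extend `N` by constant components and subtract the tangential part. The result equals `N` at
  -- `u`, so it is nonzero nearby and can be normalized.
  let ν₀ : Eu k → Eu n := fun t => N - fderiv ℝ f t (tangentPart g f (fun _ => N) t)
  have hν₀ : ContDiffOn ℝ ∞ ν₀ O := contDiffOn_const.sub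
    ((F.smooth.fderiv_of_isOpen F.isOpen (by simp)).clm_apply
      (F.contDiffOn_tangentPart S contDiffOn_const))
  have hperp : ∀ t ∈ O, ∀ v, g (f t) (ν₀ t) (fderiv ℝ f t v) = 0 := by
    intro t ht v
    simp only [ν₀, map_sub, _root_.sub_apply]
    rw [F.inner_tangentPart S ht, sub_self]
  have hν₀u : ν₀ u = N := by
    have h0 : tangentPart g f (fun _ => N) u = 0 := by
      ext i; simp [tangentPart, hN']
    simp [ν₀, h0]
  let q : Eu k → ℝ := fun t => g (f t) (ν₀ t) (ν₀ t)
  have hq : ContDiffOn ℝ ∞ q O :=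
    ((S.smooth_g.comp F.smooth F.maps).clm_apply hν₀).clm_apply hν₀
  have hqu : q u = 1 := by simp only [q, hν₀u, hN]
  let O' : Set (Eu k) := O ∩ q ⁻¹' Set.Ioi 0
  have hO' : IsOpen O' := hq.continuousOn.isOpen_inter_preimage F.isOpen isOpen_Ioi
  refine ⟨O', fun t => (√(q t))⁻¹ • ν₀ t, hO', Set.inter_subset_left, ⟨hu, by simp [hqu]⟩,
    ?_, ?_, ?_, by simp [hqu, hν₀u]⟩
  · have hq' : ContDiffOn ℝ ∞ (fun t => √(q t)) O' := fun t ht =>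
      ((hq.mono Set.inter_subset_left) t ht).sqrt (ne_of_gt ht.2)
    exact (hq'.inv fun t ht => (Real.sqrt_pos.2 ht.2).ne').smul (hν₀.mono Set.inter_subset_left)
  · intro t ht
    have hpos : 0 < √(q t) := Real.sqrt_pos.2 ht.2
    have : g (f t) (ν₀ t) (ν₀ t) = √(q t) * √(q t) :=
      (Real.mul_self_sqrt (le_of_lt ht.2)).symm
    simp only [map_smul, _root_.smul_apply, smul_eq_mul, this]
    field_simp
  · intro t ht v
    simp [hperp t ht.1]

/-- The mean curvature of a Ricci-biharmonic hypersurface tangent to `ξ` is, up to sign, locally a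
smooth function whose differential vanishes on `ξ` and on `V`. -/
theorem exists_meanCurvature (hn : n = k + 1) (hk : 1 ≤ k)
    (hric : ∀ y ∈ U, ∀ v : Eu n, v ≠ 0 → ∃ w : Eu n, ricci (fun y a b => g y a b) y v w ≠ 0)
    {N H : Eu k → Eu n} (hN : ∀ t ∈ O, g (f t) (N t) (N t) = 1)
    (hN' : ∀ t ∈ O, ∀ v, g (f t) (N t) (fderiv ℝ f t v) = 0)
    (hξ : ∀ t ∈ O, ∃ v, fderiv ℝ f t v = ξ (f t))
    {σ : Eu k → ℝ} (hσ : ∀ t ∈ O, σ t = ∑ i, ∑ j,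
      (gram (induced (fun y a b => g y a b) f t))⁻¹ i j
        * g (f t) (covAlong (fun y a b => g y a b) f (fun t => fderiv ℝ f t (e j)) t (e i)) (N t))
    (hH : ∀ t ∈ O, H t = (1 / (k : ℝ) * σ t) • N t)
    {b : Eu k → Eu k → Eu k → ℝ} {u : Eu k} (hu : u ∈ O)
    (hbi : bitension (fun y a b => g y a b) f H b u = 0) :
    ∃ h : Eu k → ℝ, ContDiffAt ℝ ∞ h u ∧ (∀ᶠ t in nhds u, |1 / (k : ℝ) * σ t| = |h t|) ∧
      (∃ w, fderiv ℝ f u w = ξ (f u) ∧ fderiv ℝ h u w = 0) ∧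
      (∃ v, fderiv ℝ f u v = -φ (f u) (N u) ∧ fderiv ℝ h u v = 0) := by
  obtain ⟨Γ, SΓ, hΓ⟩ := S.exists_sasakianChart
  obtain ⟨κ, Γs, hΓs, hcs, hdef⟩ := S.exists_ricci_connection (by omega) ⟨_, F.maps u hu⟩ hric SΓ
  obtain ⟨O', ν, hO', hsub, hu', hν, hν1, hν2, hνu⟩ := F.exists_normal S hu (hN u hu) (hN' u hu)
  have hw : ∀ t ∈ O, fderiv ℝ f t (tangentPart g f (fun t => ξ (f t)) t) = ξ (f t) := by
    intro t ht
    obtain ⟨v, hv⟩ := hξ t ht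
    rw [← hv]
    congr 1
    refine eq_of_inner_eq (inducedForm g f t) (F.isUnit_gram S ht) fun i => ?_
    rw [inducedForm_apply, F.inner_tangentPart S ht, inducedForm_apply, hv]
  have M : ContactHypersurface U g ξ O' f ν (tangentPart g f fun t => ξ (f t)) :=
    { isOpen := hO'
      maps := fun t ht => F.maps t (hsub ht)
      smooth_f := F.smooth.mono hsub
      smooth_ν := hν
      smooth_w := (F.contDiffOn_tangentPart S (S.smooth_ξ.comp F.smooth F.maps)).mono hsub
      unit := hν1
      normal := hν2
      spans := fun t ht x hx hx' =>
        F.eq_zero_of_orthogonal S hn (hsub ht) (hν1 t ht) (hν2 t ht) hx hx'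
      w_eq := fun t ht => hw t (hsub ht) }
  have hinj : ∀ t ∈ O', Function.Injective (fderiv ℝ f t) := fun t ht => F.injective t (hsub ht)
  -- The sign reflects `∇_v ν = -A v` for the shape operator of `ν`.
  let h : Eu k → ℝ := fun t => -(1 / (k : ℝ)) * traceNu g Γ f ν t
  have hsm : ContDiffOn ℝ ∞ h O' := fun t ht =>
    (contDiffAt_const.mul (contDiffAt_traceNu SΓ M hinj ht)).contDiffWithinAt
  have hNν : ∀ t ∈ O', ∃ s : ℝ, s * s = 1 ∧ N t = s • ν t := by
    intro t ht
    have h1 := exists_smul_normal M ht (hN' t (hsub ht))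
    refine ⟨_, ?_, h1⟩
    have h2 := hN t (hsub ht)
    rw [h1] at h2
    simpa [hν1 t ht] using h2
  have hσν : ∀ t ∈ O', ∀ s : ℝ, N t = s • ν t → 1 / (k : ℝ) * σ t = s * h t := by
    intro t ht s hs
    have hU := F.maps t (hsub ht)
    have : σ t = -s * traceNu g Γ f ν t := by
      rw [hσ t (hsub ht), traceNu, Finset.mul_sum]
      refine Finset.sum_congr rfl fun i _ => ?_
      rw [Finset.mul_sum]
      refine Finset.sum_congr rfl fun j _ => ?_
      have hcov : covAlong (fun y a b => g y a b) f (fun t => fderiv ℝ f t (e j)) t (e i)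
          = covField Γ f (fun t => fderiv ℝ f t (e j)) t (e i) := by
        rw [covAlong, covField, hΓ _ hU]
      rw [hcov, hs, inner_covField_ν SΓ M ht, S.symm _ hU (ν t), induced_eq]
      simp only [map_smul, smul_eq_mul]
      ring
    rw [this]; simp only [h]; ring
  -- A change of sign of `N` changes both factors of `H`, so `H` is smooth even where `N` is not.
  have hHν : ∀ t ∈ O', H t = h t • ν t := by
    intro t ht
    obtain ⟨s, hs, hN⟩ := hNν t ht
    rw [hH t (hsub ht), hσν t ht s hN, hN, smul_smul]
    congr 1
    rw [mul_right_comm, hs, one_mul]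
  refine ⟨h, hsm.contDiffAt (hO'.mem_nhds hu'), ?_,
    ⟨tangentPart g f (fun t => ξ (f t)) u, hw u hu, ?_⟩, ?_⟩
  · filter_upwards [hO'.mem_nhds hu'] with t ht
    obtain ⟨s, hs, hN⟩ := hNν t ht
    rw [hσν t ht s hN, abs_mul]
    have : |s| = 1 := by
      rcases mul_self_eq_one_iff.1 hs with rfl | rfl <;> simp
    rw [this, one_mul]
  · have hd := (contDiffAt_traceNu SΓ M hinj hu').differentiableAt (by simp)
    have : fderiv ℝ h u = -(1 / (k : ℝ)) • fderiv ℝ (traceNu g Γ f ν) u :=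
      (hd.hasFDerivAt.const_mul _).fderiv
    rw [this, _root_.smul_apply, fderiv_traceNu_w SΓ M hinj hu', smul_zero]
  · obtain ⟨v, hv⟩ := exists_tangent SΓ M (hinj u hu') hu' (x := -φ (f u) (ν u))
      (by rw [map_neg, _root_.neg_apply, SΓ.g_φ_self (F.maps u hu), neg_zero])
    refine ⟨v, by rw [hv, hνu], ?_⟩
    have key := η_trace_secondCov SΓ M hdef hΓs (hinj u hu') hu' hsm hv
    have hU := F.maps u hu
    have hca : ∀ t ∈ O', ∀ Z v, covAlong (ricci fun y a b => g y a b) f Z t v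
        = covField Γs f Z t v := by
      intro t ht Z v
      rw [covAlong, covField, hcs _ (F.maps t (hsub ht))]
    have hsec : ∀ v x, secondCov (induced (fun y a b => g y a b) f) (ricci fun y a b => g y a b)
          f H u v x
        = covField Γs f (fun t => covField Γs f (fun t => h t • ν t) t x) u v
        - covField Γs f (fun t => h t • ν t) u
          (christoffel (induced (fun y a b => g y a b) f) u v x) := by
      intro v x
      have hev : ∀ t ∈ O', H =ᶠ[nhds t] fun t => h t • ν t := fun t ht => by
        filter_upwards [hO'.mem_nhds ht] with s hs using hHν s hs
      rw [secondCov, hca u hu', hca u hu', covField_congr Γs f (hev u hu')]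
      congr 1
      apply covField_congr
      filter_upwards [hO'.mem_nhds hu'] with t ht
      rw [hca t ht, covField_congr Γs f (hev t ht)]
    have hη : g (f u) (ξ (f u)) (H u) = 0 := by
      rw [hHν u hu', map_smul, S.symm _ hU, M.normal_ξ hu', smul_zero]
    -- Both terms of `η(R*(·, H) ·)` vanish, one because `H` is normal and the other because `η(H) =
    -- 0`. This holds before contraction, so `b` is arbitrary.
    have hR : ∀ v x, g (f u) (ξ (f u)) (riemann (ricci fun y a b => g y a b) (f u)
        (fderiv ℝ f u v) (H u) (fderiv ℝ f u x)) = 0 := by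
      intro v x
      rw [riemann_eq_curv S.isOpen hΓs hcs hU, SΓ.η_curv_deformed hdef hΓs hU, hη, hHν u hu',
        map_smul, _root_.smul_apply, hν2 u hu']
      simp
    have hz := congrArg (g (f u) (ξ (f u))) hbi
    rw [bitension, map_sub, map_zero] at hz
    have h2 : g (f u) (ξ (f u)) (traceWrt (b u) fun v w =>
        riemann (ricci fun y a b => g y a b) (f u) (fderiv ℝ f u v) (H u) (fderiv ℝ f u w)) = 0 := by
      simp only [traceWrt, map_sum, map_smul, hR, smul_zero, Finset.sum_const_zero]
    have hsec' : secondCov (induced (fun y a b => g y a b) f) (ricci fun y a b => g y a b) f H u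
        = fun v x => covField Γs f (fun t => covField Γs f (fun t => h t • ν t) t x) u v
        - covField Γs f (fun t => h t • ν t) u
          (christoffel (induced (fun y a b => g y a b) f) u v x) := by
      funext v x; exact hsec v x
    rw [h2, hsec', key] at hz
    linarith

end ImmersionChart

end Local

/-! ### From the manifold to coordinates. -/

section Charts

variable {n k : ℕ} {P : Type*} [TopologicalSpace P] [ChartedSpace (Eu n) P]
  {c : OpenPartialHomeomorph P (Eu n)}

lemma ofCoord_add (c : OpenPartialHomeomorph P (Eu n)) (y v w : Eu n) :
    ofCoord c y (v + w) = ofCoord c y v + ofCoord c y w := map_add _ _ _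

lemma ofCoord_smul (c : OpenPartialHomeomorph P (Eu n)) (y v : Eu n) (r : ℝ) :
    ofCoord c y (r • v) = r • ofCoord c y v := map_smul _ _ _

lemma toCoord_add (c : OpenPartialHomeomorph P (Eu n)) (x : P) (v w : TangentSpace (𝓡 n) x) :
    toCoord c x (v + w) = toCoord c x v + toCoord c x w := map_add _ _ _

lemma toCoord_smul (c : OpenPartialHomeomorph P (Eu n)) (x : P) (r : ℝ)
    (v : TangentSpace (𝓡 n) x) : toCoord c x (r • v) = r • toCoord c x v := map_smul _ _ _

lemma toCoord_neg (c : OpenPartialHomeomorph P (Eu n)) (x : P)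
    (v : TangentSpace (𝓡 n) x) : toCoord c x (-v) = -toCoord c x v := map_neg _ _

variable [IsManifold (𝓡 n) ∞ P]

lemma contMDiffOn_of_atlas (hc : c ∈ atlas (Eu n) P) : ContMDiffOn (𝓡 n) (𝓡 n) ∞ c c.source :=
  contMDiffOn_of_mem_maximalAtlas (IsManifold.subset_maximalAtlas hc)

lemma contMDiffOn_atlas_symm (hc : c ∈ atlas (Eu n) P) :
    ContMDiffOn (𝓡 n) (𝓡 n) ∞ c.symm c.target :=
  contMDiffOn_symm_of_mem_maximalAtlas (IsManifold.subset_maximalAtlas hc)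

lemma mdifferentiable_of_atlas (hc : c ∈ atlas (Eu n) P) : c.MDifferentiable (𝓡 n) (𝓡 n) :=
  mdifferentiable_of_mem_atlas hc

lemma toCoord_ofCoord (hc : c ∈ atlas (Eu n) P) {y : Eu n} (hy : y ∈ c.target) (v : Eu n) :
    toCoord c (c.symm y) (ofCoord c y v) = v :=
  DFunLike.congr_fun ((mdifferentiable_of_atlas hc).comp_symm_deriv hy) v

lemma ofCoord_toCoord (hc : c ∈ atlas (Eu n) P) {x : P} (hx : x ∈ c.source)
    (v : TangentSpace (𝓡 n) x) : ofCoord c (c x) (toCoord c x v) = v :=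
  DFunLike.congr_fun ((mdifferentiable_of_atlas hc).symm_comp_deriv hx) v

lemma ofCoord_toCoord' (hc : c ∈ atlas (Eu n) P) {y : Eu n} (hy : y ∈ c.target)
    (v : TangentSpace (𝓡 n) (c.symm y)) : ofCoord c y (toCoord c (c.symm y) v) = v := by
  have h := ofCoord_toCoord hc (c.map_target hy) v
  -- All tangent spaces have the same model space; forgetting the base point in the type allows that
  -- point to be rewritten.
  let F : Eu n → Eu n → Eu n := fun y a => ofCoord c y a
  have h' : F (c (c.symm y)) (toCoord c (c.symm y) v) = v := h
  rw [c.right_inv hy] at h'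
  exact h'

lemma toCoord_injective (hc : c ∈ atlas (Eu n) P) {x : P} (hx : x ∈ c.source) :
    Function.Injective (toCoord c x) :=
  (mdifferentiable_of_atlas hc).mfderiv_injective hx

lemma ofCoord_injective (hc : c ∈ atlas (Eu n) P) {y : Eu n} (hy : y ∈ c.target) :
    Function.Injective (ofCoord c y) := fun a b h => by
  rw [← toCoord_ofCoord hc hy a, h, toCoord_ofCoord hc hy b]

/-- Coordinate vector fields are smooth. -/
lemma contMDiffOn_ofCoord (hc : c ∈ atlas (Eu n) P) (v : Eu n) :
    ContMDiffOn (𝓡 n) (𝓡 n).tangent ∞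
      (fun y => (⟨c.symm y, ofCoord c y v⟩ : TangentBundle (𝓡 n) P)) c.target := by
  have h1 := (contMDiffOn_atlas_symm hc).contMDiffOn_tangentMapWithin (m := ∞) (by simp)
    c.open_target.uniqueMDiffOn
  have h2 : ContMDiffOn (𝓡 n) (𝓡 n).tangent ∞
      (fun y : Eu n => (⟨y, v⟩ : TangentBundle (𝓡 n) (Eu n))) c.target :=
    contMDiffOn_vectorSpace_iff_contDiffOn.2 contDiffOn_const
  have h3 := h1.comp h2 fun y hy => hy
  refine h3.congr fun y hy => ?_
  simp only [Function.comp_apply, tangentMapWithin]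
  rw [mfderivWithin_of_isOpen c.open_target hy]
  rfl

/-- The coordinate expression of a smooth vector field is smooth. -/
lemma contDiffOn_toCoord (hc : c ∈ atlas (Eu n) P)
    {Z : ∀ y : Eu n, TangentSpace (𝓡 n) (c.symm y)}
    (hZ : ContMDiffOn (𝓡 n) (𝓡 n).tangent ∞
      (fun y => (⟨c.symm y, Z y⟩ : TangentBundle (𝓡 n) P)) c.target) :
    ContDiffOn ℝ ∞ (fun y => toCoord c (c.symm y) (Z y)) c.target := by
  have h1 := (contMDiffOn_of_atlas hc).contMDiffOn_tangentMapWithin (m := ∞) (by simp)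
    c.open_source.uniqueMDiffOn
  have h3 := h1.comp hZ fun y hy => c.map_target hy
  have h4 := (contMDiff_snd_tangentBundle_modelSpace (n := ∞) (Eu n) (𝓡 n)).comp_contMDiffOn h3
  refine (contMDiffOn_iff_contDiffOn.1 h4).congr fun y hy => ?_
  change toCoord c (c.symm y) (Z y) = mfderivWithin (𝓡 n) (𝓡 n) c c.source (c.symm y) (Z y)
  rw [mfderivWithin_of_isOpen c.open_source (c.map_target hy)]
  rfl

namespace ContactData

variable (S : ContactData n P)

/-- The metric in a chart, as a field of continuous bilinear forms. -/
def metricIn (c : OpenPartialHomeomorph P (Eu n)) (y : Eu n) : Eu n →L[ℝ] Eu n →L[ℝ] ℝ :=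
  toContinuousBilin (LinearMap.mk₂ ℝ (S.gIn c y)
    (fun a b w => by simp [gIn, ofCoord_add])
    (fun r a w => by simp [gIn, ofCoord_smul])
    (fun a b w => by simp [gIn, ofCoord_add])
    (fun r a w => by simp [gIn, ofCoord_smul]))

/-- The structure tensor `φ` in a chart, as a field of endomorphisms. -/
def φIn (c : OpenPartialHomeomorph P (Eu n)) (y : Eu n) : Eu n →L[ℝ] Eu n :=
  LinearMap.toContinuousLinearMap
    { toFun := endoIn c S.φ y
      map_add' := fun a b => by simp only [endoIn, ofCoord_add, map_add, toCoord_add]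
      map_smul' := fun r a => by
        simp only [endoIn, ofCoord_smul, map_smul, toCoord_smul, RingHom.id_apply] }

lemma contDiffOn_metricIn (hc : c ∈ atlas (Eu n) P) : ContDiffOn ℝ ∞ (S.metricIn c) c.target := by
  rw [contDiffOn_clm_apply_iff₂]
  intro v w
  have h : ContMDiffOn (𝓡 n) ((𝓡 n).prod 𝓘(ℝ)) ∞ (fun y => Bundle.TotalSpace.mk' ℝ
      (E := Bundle.Trivial P ℝ) (c.symm y)
        (S.g.inner (c.symm y) (ofCoord c y v) (ofCoord c y w))) c.target := by
    intro y hy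
    apply ContMDiffWithinAt.clm_bundle_apply₂ (F₁ := Eu n) (F₂ := Eu n)
    · exact S.g.contMDiff.contMDiffAt.comp_contMDiffWithinAt y (contMDiffOn_atlas_symm hc y hy)
    · exact contMDiffOn_ofCoord hc v y hy
    · exact contMDiffOn_ofCoord hc w y hy
  rw [← contMDiffOn_iff_contDiffOn]
  intro y hy
  have hy' := h y hy
  simp only [Bundle.contMDiffWithinAt_totalSpace] at hy'
  exact hy'.2

lemma contDiffOn_φIn (hc : c ∈ atlas (Eu n) P) : ContDiffOn ℝ ∞ (S.φIn c) c.target := by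
  rw [contDiffOn_clm_apply]
  intro v
  refine contDiffOn_toCoord hc (Z := fun y => S.φ (c.symm y) (ofCoord c y v)) ?_
  intro y hy
  apply ContMDiffWithinAt.clm_bundle_apply (F₁ := Eu n) (F₂ := Eu n)
  · exact S.smooth_φ.contMDiffAt.comp_contMDiffWithinAt y (contMDiffOn_atlas_symm hc y hy)
  · exact contMDiffOn_ofCoord hc v y hy

lemma contDiffOn_ξIn (hc : c ∈ atlas (Eu n) P) : ContDiffOn ℝ ∞ (S.ξIn c) c.target :=
  contDiffOn_toCoord hc (Z := fun y => S.ξ (c.symm y)) fun y hy =>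
    S.smooth_ξ.contMDiffAt.comp_contMDiffWithinAt y (contMDiffOn_atlas_symm hc y hy)

lemma metricIn_toCoord (hc : c ∈ atlas (Eu n) P) {x : P} (hx : x ∈ c.source)
    (v w : TangentSpace (𝓡 n) x) :
    S.metricIn c (c x) (toCoord c x v) (toCoord c x w) = S.g.inner x v w := by
  let F : P → Eu n → Eu n → ℝ := fun x a b => S.g.inner x a b
  have h : S.metricIn c (c x) (toCoord c x v) (toCoord c x w)
      = F (c.symm (c x)) (ofCoord c (c x) (toCoord c x v)) (ofCoord c (c x) (toCoord c x w)) := rfl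
  rw [h, ofCoord_toCoord hc hx, ofCoord_toCoord hc hx, c.left_inv hx]

lemma φIn_toCoord (hc : c ∈ atlas (Eu n) P) {x : P} (hx : x ∈ c.source)
    (v : TangentSpace (𝓡 n) x) :
    S.φIn c (c x) (toCoord c x v) = toCoord c x (S.φ x v) := by
  let F : P → Eu n → Eu n := fun x a => toCoord c x (S.φ x a)
  have h : S.φIn c (c x) (toCoord c x v) = F (c.symm (c x)) (ofCoord c (c x) (toCoord c x v)) := rfl
  rw [h, ofCoord_toCoord hc hx, c.left_inv hx]

lemma ξIn_chart {x : P} (hx : x ∈ c.source) : S.ξIn c (c x) = toCoord c x (S.ξ x) := by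
  rw [ξIn, c.left_inv hx]

variable {S}

lemma metricIn_ξIn (hS : S.IsAlmostContactMetric) (hc : c ∈ atlas (Eu n) P) {y : Eu n}
    (hy : y ∈ c.target) (v : Eu n) : S.metricIn c y (S.ξIn c y) v = S.ηIn c y v := by
  have h : S.metricIn c y (S.ξIn c y) v
      = S.g.inner (c.symm y) (ofCoord c y (toCoord c (c.symm y) (S.ξ (c.symm y))))
        (ofCoord c y v) := rfl
  rw [h, ofCoord_toCoord' hc hy, ← hS.η_eq]
  rfl

/-- The pointwise identities are pulled back through `ofCoord`, which is injective on the chart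
target; the differential ones are assumed in charts, up to writing `η` as `g(ξ, ·)`. -/
lemma spaceFormChart {κ : ℝ} (hS : S.IsSasakianSpaceForm κ) (hc : c ∈ atlas (Eu n) P) :
    SpaceFormChart c.target (S.metricIn c) (S.φIn c) (S.ξIn c) κ := by
  have hacm := hS.toIsAlmostContactMetric
  have hη : ∀ y ∈ c.target, ∀ v, S.metricIn c y (S.ξIn c y) v = S.ηIn c y v := fun y hy v =>
    metricIn_ξIn hacm hc hy v
  have hoξ : ∀ y ∈ c.target, ofCoord c y (S.ξIn c y) = S.ξ (c.symm y) := fun y hy =>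
    ofCoord_toCoord' hc hy _
  have hoφ : ∀ y ∈ c.target, ∀ v, ofCoord c y (S.φIn c y v) = S.φ (c.symm y) (ofCoord c y v) :=
    fun y hy v => ofCoord_toCoord' hc hy _
  have hg : ∀ y v w, S.metricIn c y v w
    = S.g.inner (c.symm y) (ofCoord c y v) (ofCoord c y w) := fun _ _ _ => rfl
  refine ⟨c.open_target, S.contDiffOn_metricIn hc, S.contDiffOn_φIn hc, S.contDiffOn_ξIn hc,
    fun y _ v w => S.g.symm _ _ _, fun y hy v hv => ?_, fun y hy => ?_, fun y hy => ?_,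
    fun y hy v => ?_, fun y hy v w => ?_, ?_, ?_⟩
  · refine S.g.pos _ _ fun h => hv (ofCoord_injective hc hy ?_)
    rw [h]; exact (map_zero (mfderiv (𝓡 n) (𝓡 n) c.symm y)).symm
  · rw [hη y hy, ηIn, hoξ y hy, hacm.η_ξ]
  · apply ofCoord_injective hc hy
    rw [hoφ y hy, hoξ y hy, hacm.φ_ξ]
    exact (map_zero (mfderiv (𝓡 n) (𝓡 n) c.symm y)).symm
  · apply ofCoord_injective hc hy
    have hneg : ofCoord c y (-v) = -ofCoord c y v := map_neg (mfderiv (𝓡 n) (𝓡 n) c.symm y) v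
    rw [hoφ y hy, hoφ y hy, hacm.φ_sq, ofCoord_add, ofCoord_smul, hoξ y hy, hη y hy, ηIn, hneg]
  · rw [hη y hy, hη y hy, hg, hoφ y hy, hoφ y hy, hacm.g_φ, hg]
    rfl
  · exact fun y hy v w => hS.cov_φ c hc y hy v w
  · intro y hy u v w
    have h := hS.curvature c hc y hy u v w
    simp only [hη y hy]
    exact h

end ContactData

end Charts

section Immersion

variable {n k : ℕ} {P : Type*} [TopologicalSpace P] [ChartedSpace (Eu n) P]
  [IsManifold (𝓡 n) ∞ P] {M : Type*} [TopologicalSpace M] [ChartedSpace (Eu k) M]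
  [IsManifold (𝓡 k) ∞ M] {c : OpenPartialHomeomorph M (Eu k)} {d : OpenPartialHomeomorph P (Eu n)}
  {ψ : M → P}

lemma contMDiffOn_mapIn (hψ : ContMDiff (𝓡 k) (𝓡 n) ∞ ψ) (hc : c ∈ atlas (Eu k) M)
    (hd : d ∈ atlas (Eu n) P) : ContMDiffOn (𝓡 k) (𝓡 n) ∞ (mapIn c d ψ) (domIn c d ψ) :=
  (contMDiffOn_of_atlas hd).comp (hψ.comp_contMDiffOn ((contMDiffOn_atlas_symm hc).mono
    fun _ h => h.1)) fun _ h => h.2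

omit [ChartedSpace (Eu n) P] [IsManifold (𝓡 n) ∞ P] [ChartedSpace (Eu k) M]
  [IsManifold (𝓡 k) ∞ M] in
lemma isOpen_domIn (hψ : Continuous ψ) : IsOpen (domIn c d ψ) :=
  (hψ.comp_continuousOn c.continuousOn_symm).isOpen_inter_preimage c.open_target d.open_source

lemma fderiv_mapIn (hψ : ContMDiff (𝓡 k) (𝓡 n) ∞ ψ) (hc : c ∈ atlas (Eu k) M)
    (hd : d ∈ atlas (Eu n) P) {t : Eu k} (ht : t ∈ domIn c d ψ) (v : Eu k) :
    fderiv ℝ (mapIn c d ψ) t v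
      = toCoord d (ψ (c.symm t)) (mfderiv (𝓡 k) (𝓡 n) ψ (c.symm t) (ofCoord c t v)) := by
  have h1 : MDifferentiableAt (𝓡 k) (𝓡 k) c.symm t :=
    (mdifferentiable_of_atlas hc).mdifferentiableAt_symm ht.1
  have h2 : MDifferentiableAt (𝓡 k) (𝓡 n) ψ (c.symm t) := hψ.mdifferentiableAt (by simp)
  have h3 : MDifferentiableAt (𝓡 n) (𝓡 n) d (ψ (c.symm t)) :=
    (mdifferentiable_of_atlas hd).mdifferentiableAt ht.2
  have h4 := mfderiv_comp t (g := ψ) h2 h1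
  have h5 := mfderiv_comp t (g := d) (f := ψ ∘ c.symm) h3 (h2.comp t h1)
  rw [← mfderiv_eq_fderiv]
  have h6 : mapIn c d ψ = d ∘ ψ ∘ c.symm := rfl
  rw [h6, h5, h4]
  rfl

lemma immersionChart (hψ : IsSmoothImmersion (k := k) (n := n) ψ) (hc : c ∈ atlas (Eu k) M)
    (hd : d ∈ atlas (Eu n) P) : ImmersionChart d.target (domIn c d ψ) (mapIn c d ψ) where
  isOpen := isOpen_domIn hψ.1.continuous
  maps _ h := d.map_source h.2
  smooth := contMDiffOn_iff_contDiffOn.1 (contMDiffOn_mapIn hψ.1 hc hd)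
  injective t ht v w h := by
    rw [fderiv_mapIn hψ.1 hc hd ht, fderiv_mapIn hψ.1 hc hd ht] at h
    exact ofCoord_injective hc ht.1 (hψ.2 _ (toCoord_injective hd ht.2 h))

end Immersion

/-- If a differentiable function is locally the absolute value of `h`, then its differential
vanishes where that of `h` does. -/
lemma fderiv_eq_zero_of_eventuallyEq_abs {E : Type*} [NormedAddCommGroup E] [NormedSpace ℝ E]
    {ρ h : E → ℝ} {u w : E} (hρ : DifferentiableAt ℝ ρ u) (hh : DifferentiableAt ℝ h u)
    (he : ∀ᶠ t in nhds u, ρ t = |h t|) (hw : fderiv ℝ h u w = 0) : fderiv ℝ ρ u w = 0 := by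
  have hu : ρ u = |h u| := he.self_of_nhds
  by_cases h0 : h u = 0
  -- At a zero of `h` the function `ρ = |h|` has a minimum, so its whole differential vanishes.
  -- Elsewhere `ρ² = h²` is differentiated.
  · have hmin : IsLocalMin ρ u := by
      filter_upwards [he] with t ht
      rw [ht, hu, h0, abs_zero]
      exact abs_nonneg _
    rw [hmin.fderiv_eq_zero]; rfl
  · have he2 : (fun t => ρ t * ρ t) =ᶠ[nhds u] fun t => h t * h t := by
      filter_upwards [he] with t ht
      rw [ht, abs_mul_abs_self]
    have h1 := congrArg (fun L : E →L[ℝ] ℝ => L w) he2.fderiv_eq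
    rw [fderiv_fun_mul hρ hρ, fderiv_fun_mul hh hh] at h1
    simp only [_root_.add_apply, _root_.smul_apply, smul_eq_mul, hw, mul_zero, add_zero] at h1
    have hne : ρ u ≠ 0 := by rw [hu]; exact abs_ne_zero.2 h0
    have : ρ u * fderiv ℝ ρ u w = 0 := by linarith
    exact (mul_eq_zero.1 this).resolve_left hne

/-! ### The gradient of `|H|` on the manifold. -/

section Hypersurface

variable {n k : ℕ} {P : Type*} [TopologicalSpace P] [ChartedSpace (Eu n) P]
  [IsManifold (𝓡 n) ∞ P] {S : ContactData n P}
  {M : Type*} [TopologicalSpace M] [ChartedSpace (Eu k) M] {ψ : M → P}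
  {N : ∀ p : M, TangentSpace (𝓡 n) (ψ p)}
  {A : ∀ p : M, TangentSpace (𝓡 k) p →L[ℝ] TangentSpace (𝓡 k) p}

lemma normH_eq_abs (hN : IsUnitNormal (k := k) S ψ N) (p : M) :
    normH S ψ N A p
      = |1 / (k : ℝ) * LinearMap.trace ℝ (TangentSpace (𝓡 k) p) (A p).toLinearMap| := by
  rw [normH, meanCurv, map_smul, map_smul, _root_.smul_apply, (hN p).1, smul_eq_mul, smul_eq_mul,
    mul_one, Real.sqrt_mul_self_eq_abs]

variable [IsManifold (𝓡 k) ∞ M]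

/-- The trace of a field of endomorphisms can be computed in a chart. -/
lemma trace_endoIn {c : OpenPartialHomeomorph M (Eu k)} (hc : c ∈ atlas (Eu k) M) {t : Eu k}
    (ht : t ∈ c.target) (L : Eu k →ₗ[ℝ] Eu k) (hL : ∀ v, L v = endoIn c A t v) :
    LinearMap.trace ℝ (TangentSpace (𝓡 k) (c.symm t)) (A (c.symm t)).toLinearMap
      = LinearMap.trace ℝ (Eu k) L := by
  let T : Eu k →ₗ[ℝ] Eu k := (mfderiv (𝓡 k) (𝓡 k) c (c.symm t)).toLinearMap
  let R : Eu k →ₗ[ℝ] Eu k := (mfderiv (𝓡 k) (𝓡 k) c.symm t).toLinearMap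
  let B : Eu k →ₗ[ℝ] Eu k := (A (c.symm t)).toLinearMap
  have hRT : R ∘ₗ T = LinearMap.id := LinearMap.ext fun v => ofCoord_toCoord' hc ht v
  have hLB : L = T ∘ₗ (B ∘ₗ R) := LinearMap.ext fun v => hL v
  have h : LinearMap.trace ℝ (Eu k) L = LinearMap.trace ℝ (Eu k) B := by
    rw [hLB, LinearMap.trace_comp_comm', LinearMap.comp_assoc, hRT, LinearMap.comp_id]
  exact h.symm

/-- On a Ricci-biharmonic hypersurface tangent to `ξ`, the gradient of the mean curvature has no
component in the direction of `ξ` or `V`. -/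
theorem grad_normH_eq_zero {κ : ℝ} (hn : n = k + 1) (hk : 1 ≤ k) (hS : S.IsSasakianSpaceForm κ)
    (hric : S.RicciNondegenerate) (hψ : IsSmoothImmersion (k := k) (n := n) ψ)
    (hN : IsUnitNormal (k := k) S ψ N) (hA : IsShapeOperator S ψ N A)
    (hξ : ∀ p : M, ∃ v : TangentSpace (𝓡 k) p, mfderiv (𝓡 k) (𝓡 n) ψ p v = S.ξ (ψ p))
    (hbi : IsRicciBiharmonic S ψ N A) {α β : M → ℝ}
    (hgrad : IsGradNormH S ψ N A (fun p => α p • S.ξ (ψ p) + β p • structV S ψ N p)) (p : M) :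
    α p = 0 ∧ β p = 0 := by
  set c := chartAt (Eu k) p
  set d := chartAt (Eu n) (ψ p)
  have hc : c ∈ atlas (Eu k) M := chart_mem_atlas _ _
  have hd : d ∈ atlas (Eu n) P := chart_mem_atlas _ _
  set u := c p with hu
  have hcu : c.symm u = p := c.left_inv (mem_chart_source _ _)
  have huO : u ∈ domIn c d ψ := by
    refine ⟨c.map_source (mem_chart_source _ _), ?_⟩
    rw [hcu]; exact mem_chart_source _ _
  have SF := ContactData.spaceFormChart hS hd
  have F := immersionChart hψ hc hd
  have hacm := hS.toIsAlmostContactMetric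
  have hff : ∀ t, mapIn c d ψ t = d (ψ (c.symm t)) := fun _ => rfl
  let σ : Eu k → ℝ := fun t =>
    LinearMap.trace ℝ (TangentSpace (𝓡 k) (c.symm t)) (A (c.symm t)).toLinearMap
  have hN1 : ∀ t ∈ domIn c d ψ, S.metricIn d (mapIn c d ψ t) (alongIn c d ψ N t)
      (alongIn c d ψ N t) = 1 := fun t ht => by
    rw [hff, alongIn, S.metricIn_toCoord hd ht.2, (hN _).1]
  have hN2 : ∀ t ∈ domIn c d ψ, ∀ v, S.metricIn d (mapIn c d ψ t) (alongIn c d ψ N t)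
      (fderiv ℝ (mapIn c d ψ) t v) = 0 := fun t ht v => by
    rw [fderiv_mapIn hψ.1 hc hd ht, hff, alongIn, S.metricIn_toCoord hd ht.2, (hN _).2]
  have hξ' : ∀ t ∈ domIn c d ψ, ∃ v, fderiv ℝ (mapIn c d ψ) t v
      = S.ξIn d (mapIn c d ψ t) := fun t ht => by
    obtain ⟨v, hv⟩ := hξ (c.symm t)
    refine ⟨toCoord c (c.symm t) v, ?_⟩
    rw [fderiv_mapIn hψ.1 hc hd ht, ofCoord_toCoord' hc ht.1, hv, hff, S.ξIn_chart ht.2]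
  have hσ : ∀ t ∈ domIn c d ψ, σ t = ∑ i, ∑ j,
      (gram (induced (fun y a b => S.metricIn d y a b) (mapIn c d ψ) t))⁻¹ i j
        * S.metricIn d (mapIn c d ψ t) (covAlong (fun y a b => S.metricIn d y a b) (mapIn c d ψ)
          (fun t => fderiv ℝ (mapIn c d ψ) t (e j)) t (e i)) (alongIn c d ψ N t) := by
    intro t ht
    let L : Eu k →ₗ[ℝ] Eu k :=
      { toFun := endoIn c A t
        map_add' := fun a b => by simp only [endoIn, ofCoord_add, map_add, toCoord_add]
        map_smul' := fun r a => by
          simp only [endoIn, ofCoord_smul, map_smul, toCoord_smul, RingHom.id_apply] }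
    have hU := F.maps t ht
    have h1 : σ t = _ := trace_endoIn hc ht.1 L fun v => rfl
    rw [h1, trace_eq_sum_gram_inv (ContactHypersurface.inducedForm (S.metricIn d) (mapIn c d ψ) t)
      (fun _ _ => SF.symm _ hU _ _) (F.isUnit_gram SF ht) L, ContactHypersurface.induced_eq]
    refine Finset.sum_congr rfl fun i _ => Finset.sum_congr rfl fun j _ => ?_
    congr 1
    exact hA c hc d hd t ht (e i) (e j)
  have hH : ∀ t ∈ domIn c d ψ, alongIn c d ψ (meanCurv ψ N A) t
      = (1 / (k : ℝ) * σ t) • alongIn c d ψ N t := fun t _ => by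
    rw [alongIn, meanCurv, toCoord_smul]; rfl
  have hric' : ∀ y ∈ d.target, ∀ v : Eu n, v ≠ 0 →
      ∃ w : Eu n, ricci (fun y a b => S.metricIn d y a b) y v w ≠ 0 := hric d hd
  -- Both contraction conventions are instances of the bitension equation with some `b`.
  have hex : ∃ b : Eu k → Eu k → Eu k → ℝ, bitension (fun y a b => S.metricIn d y a b)
      (mapIn c d ψ) (alongIn c d ψ (meanCurv ψ N A)) b u = 0 := by
    rcases hbi with h | h
    · exact ⟨_, h c hc d hd u huO⟩
    · exact ⟨_, h c hc d hd u huO⟩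
  obtain ⟨b, hb⟩ := hex
  obtain ⟨h, hh, habs, ⟨w, hw, hw0⟩, ⟨v, hv, hv0⟩⟩ :=
    F.exists_meanCurvature SF hn hk hric' hN1 hN2 hξ' hσ hH huO hb
  obtain ⟨hdiff, hdir⟩ := hgrad p
  have hcs : MDifferentiableAt (𝓡 k) (𝓡 k) c.symm u :=
    (mdifferentiable_of_atlas hc).mdifferentiableAt_symm huO.1
  have hdiff' : MDifferentiableAt (𝓡 k) 𝓘(ℝ, ℝ) (normH S ψ N A) (c.symm u) := by
    rw [hcu]; exact hdiff
  have hρ : DifferentiableAt ℝ (fun t => normH S ψ N A (c.symm t)) u :=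
    mdifferentiableAt_iff_differentiableAt.1 (hdiff'.comp u hcs)
  have heq : ∀ᶠ t in nhds u, normH S ψ N A (c.symm t) = |h t| := by
    filter_upwards [habs] with t ht
    rw [normH_eq_abs hN, ← ht]
  have hdρ : ∀ x, fderiv ℝ h u x = 0 →
      S.g.inner (ψ p) (α p • S.ξ (ψ p) + β p • structV S ψ N p)
        (mfderiv (𝓡 k) (𝓡 n) ψ p (ofCoord c u x)) = 0 := by
    intro x hx
    have h1 := fderiv_eq_zero_of_eventuallyEq_abs hρ (hh.differentiableAt (by simp)) heq hx
    have h2 := mfderiv_comp u (g := normH S ψ N A) hdiff' hcs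
    have h3 : fderiv ℝ (fun t => normH S ψ N A (c.symm t)) u x
        = mfderiv (𝓡 k) 𝓘(ℝ, ℝ) (normH S ψ N A) (c.symm u) (ofCoord c u x) := by
      rw [← mfderiv_eq_fderiv]
      exact DFunLike.congr_fun h2 x
    have h4 : ∀ q, q = p → ∀ a : Eu k, mfderiv (𝓡 k) 𝓘(ℝ, ℝ) (normH S ψ N A) q a
        = mfderiv (𝓡 k) 𝓘(ℝ, ℝ) (normH S ψ N A) p a := by
      rintro q rfl a; rfl
    exact (hdir (ofCoord c u x)).symm.trans ((h4 _ hcu _).symm.trans (h3.symm.trans h1))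
  have hpush : ∀ x, fderiv ℝ (mapIn c d ψ) u x
      = toCoord d (ψ p) (mfderiv (𝓡 k) (𝓡 n) ψ p (ofCoord c u x)) := by
    intro x
    rw [fderiv_mapIn hψ.1 hc hd huO]
    have h4 : ∀ q, q = p → ∀ a : Eu k,
        (toCoord d (ψ q) (mfderiv (𝓡 k) (𝓡 n) ψ q a) : Eu n)
          = toCoord d (ψ p) (mfderiv (𝓡 k) (𝓡 n) ψ p a) := by
      rintro q rfl a; rfl
    exact h4 _ hcu _
  have hmap : mapIn c d ψ u = d (ψ p) := by rw [hff, hcu]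
  have hNp : alongIn c d ψ N u = toCoord d (ψ p) (N p) := by
    have h4 : ∀ q, q = p → (toCoord d (ψ q) (N q) : Eu n) = toCoord d (ψ p) (N p) := by
      rintro q rfl; rfl
    exact h4 _ hcu
  have hsrc : ψ p ∈ d.source := mem_chart_source _ _
  have hwξ : mfderiv (𝓡 k) (𝓡 n) ψ p (ofCoord c u w) = S.ξ (ψ p) := by
    apply toCoord_injective hd hsrc
    rw [← hpush, hw, hmap, S.ξIn_chart hsrc]
  have hvV : mfderiv (𝓡 k) (𝓡 n) ψ p (ofCoord c u v) = structV S ψ N p := by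
    apply toCoord_injective hd hsrc
    rw [← hpush, hv, hmap, hNp, S.φIn_toCoord hd hsrc, structV, toCoord_neg]
  -- The gradient is orthogonal to `ξ` and to `V`; since these are orthonormal, its coefficients `α`
  -- and `β` are zero.
  have e1 := hdρ w hw0
  have e2 := hdρ v hv0
  rw [hwξ] at e1
  rw [hvV] at e2
  have hξN : S.g.inner (ψ p) (S.ξ (ψ p)) (N p) = 0 := by
    have h : S.g.inner (ψ p) (N p) (mfderiv (𝓡 k) (𝓡 n) ψ p (ofCoord c u w)) = 0 := (hN p).2 _
    rw [hwξ] at h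
    rw [S.g.symm, h]
  have hξξ : S.g.inner (ψ p) (S.ξ (ψ p)) (S.ξ (ψ p)) = 1 := by
    rw [← hacm.η_eq, hacm.η_ξ]
  have hVV : S.g.inner (ψ p) (structV S ψ N p) (structV S ψ N p) = 1 := by
    have := hacm.g_φ (ψ p) (N p) (N p)
    rw [hacm.η_eq, hξN, (hN p).1] at this
    simp [structV, this]
  have hξV : S.g.inner (ψ p) (S.ξ (ψ p)) (structV S ψ N p) = 0 := by
    have h1 := SF.η_φ (d.map_source hsrc) (toCoord d (ψ p) (N p))
    rw [S.φIn_toCoord hd hsrc, S.ξIn_chart hsrc, S.metricIn_toCoord hd hsrc] at h1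
    simp [structV, h1]
  have hVξ : S.g.inner (ψ p) (structV S ψ N p) (S.ξ (ψ p)) = 0 := by rw [S.g.symm, hξV]
  simp only [map_add, map_smul, _root_.add_apply, _root_.smul_apply, smul_eq_mul] at e1 e2
  rw [hξξ, hVξ] at e1
  rw [hξV, hVV] at e2
  exact ⟨by linarith, by linarith⟩

/-- A function on a connected manifold whose differential vanishes is constant. -/
lemma exists_eq_const_of_mfderiv_eq_zero [ConnectedSpace M] {ρ : M → ℝ}
    (hρ : ∀ p, MDifferentiableAt (𝓡 k) 𝓘(ℝ, ℝ) ρ p)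
    (h0 : ∀ (p : M) (v : TangentSpace (𝓡 k) p), mfderiv (𝓡 k) 𝓘(ℝ, ℝ) ρ p v = 0) :
    ∃ κ : ℝ, ∀ p, ρ p = κ := by
  have hloc : IsLocallyConstant ρ := by
    rw [IsLocallyConstant.iff_eventually_eq]
    intro p
    set c := chartAt (Eu k) p
    have hc : c ∈ atlas (Eu k) M := chart_mem_atlas _ _
    have hp : p ∈ c.source := mem_chart_source _ _
    obtain ⟨r, hr, hball⟩ := Metric.isOpen_iff.1 c.open_target (c p) (c.map_source hp)
    have hdiff : ∀ t ∈ c.target, HasFDerivAt (fun t => ρ (c.symm t)) (0 : Eu k →L[ℝ] ℝ) t := by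
      intro t ht
      have hcs : MDifferentiableAt (𝓡 k) (𝓡 k) c.symm t :=
        (mdifferentiable_of_atlas hc).mdifferentiableAt_symm ht
      have hd : DifferentiableAt ℝ (fun t => ρ (c.symm t)) t :=
        mdifferentiableAt_iff_differentiableAt.1 ((hρ _).comp t hcs)
      have hz : fderiv ℝ (fun t => ρ (c.symm t)) t = 0 := by
        ext1 x
        rw [← mfderiv_eq_fderiv]
        exact (DFunLike.congr_fun (mfderiv_comp t (g := ρ) (hρ _) hcs) x).trans (h0 _ _)
      rw [← hz]; exact hd.hasFDerivAt
    have hconst : ∀ t ∈ Metric.ball (c p) r, ρ (c.symm t) = ρ (c.symm (c p)) := by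
      intro t ht
      refine Metric.isOpen_ball.is_const_of_fderiv_eq_zero (𝕜 := ℝ)
        (f := fun t => ρ (c.symm t)) (convex_ball (c p) r).isPreconnected
        (fun s hs => (hdiff s (hball hs)).differentiableAt.differentiableWithinAt)
        (fun s hs => (hdiff s (hball hs)).fderiv) ht (Metric.mem_ball_self hr)
    have hnhds : ∀ᶠ q in nhds p, q ∈ c.source ∧ c q ∈ Metric.ball (c p) r :=
      (c.open_source.mem_nhds hp |> fun h => Filter.eventually_of_mem h fun _ h => h).and
        ((c.continuousAt hp).eventually (Metric.ball_mem_nhds _ hr))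
    filter_upwards [hnhds] with q hq
    have := hconst (c q) hq.2
    rwa [c.left_inv hq.1, c.left_inv hp] at this
  obtain ⟨p₀⟩ := (inferInstance : Nonempty M)
  exact ⟨ρ p₀, fun p => hloc.apply_eq_of_preconnectedSpace p p₀⟩

end Hypersurface

end

theorem mainTheorem4 :
    ∃ m₀ : ℕ, ∀ (m : ℕ), 1 ≤ m → ∀ (c : ℝ)
      (P : Type*) [TopologicalSpace P] [ChartedSpace (Eu (2 * m + 1)) P]
      [IsManifold (𝓡 (2 * m + 1)) ∞ P]
      (S : ContactData (2 * m + 1) P), S.IsSasakianSpaceForm c → S.RicciNondegenerate →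
    ∀ (M : Type*) [TopologicalSpace M] [ChartedSpace (Eu (2 * m)) M]
      [IsManifold (𝓡 (2 * m)) ∞ M]
      (ψ : M → P), IsSmoothImmersion (k := 2 * m) (n := 2 * m + 1) ψ →
    ∀ (N : ∀ p : M, TangentSpace (𝓡 (2 * m + 1)) (ψ p))
      (A : ∀ p : M, TangentSpace (𝓡 (2 * m)) p →L[ℝ] TangentSpace (𝓡 (2 * m)) p),
      IsUnitNormal (k := 2 * m) S ψ N → IsShapeOperator S ψ N A →
      IsPseudoHopf S ψ N A → IsRicciBiharmonic S ψ N A →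
    ∀ (α β : M → ℝ),
      IsGradNormH S ψ N A (fun p => α p • S.ξ (ψ p) + β p • structV S ψ N p) →
      -- if `α = 0`, the mean curvature is constant
      (ConnectedSpace M → (∀ p, α p = 0) → ∃ κ : ℝ, ∀ p, normH S ψ N A p = κ) ∧
      -- nonexistence for `α ≠ 0`, large dimension and `c > 1`
      (m₀ ≤ m → 1 < c → ¬ ∃ p, α p ≠ 0) ∧
      -- the formula for `|H|` where `α ≠ 0` and `γ₁ + γ₂ ≠ 0`
      (∀ (p : M) (θ γ₁ γ₂ : ℝ) (W₁ W₂ : TangentSpace (𝓡 (2 * m)) p),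
        α p ≠ 0 →
        meanCurv ψ N A p = normH S ψ N A p • N p →
        0 < θ → θ < Real.pi / 2 →
        mfderiv (𝓡 (2 * m)) (𝓡 (2 * m + 1)) ψ p W₁
          = Real.cos θ • S.ξ (ψ p) + Real.sin θ • structV S ψ N p →
        mfderiv (𝓡 (2 * m)) (𝓡 (2 * m + 1)) ψ p W₂
          = -(Real.sin θ • S.ξ (ψ p)) + Real.cos θ • structV S ψ N p →
        A p W₁ = γ₁ • W₁ → A p W₂ = γ₂ • W₂ →
        γ₁ + γ₂ ≠ 0 →
        (c < (1 - 3 * m) / (1 + m) ∨ 1 < c) ∧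
        0 ≤ (-(4 * (-1 + c) * m ^ 2 * (1 + m) / (-1 + c + 3 * m + c * m))
              + (-1 + m * (γ₁ + γ₂)) ^ 2) / m ^ 4 ∧
        (normH S ψ N A p = 1 / 2 * (-((-1 + m * (γ₁ + γ₂)) / m ^ 2)
            + √((-(4 * (-1 + c) * m ^ 2 * (1 + m) / (-1 + c + 3 * m + c * m))
              + (-1 + m * (γ₁ + γ₂)) ^ 2) / m ^ 4)) ∨
         normH S ψ N A p = 1 / 2 * (-((-1 + m * (γ₁ + γ₂)) / m ^ 2)
            - √((-(4 * (-1 + c) * m ^ 2 * (1 + m) / (-1 + c + 3 * m + c * m))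
              + (-1 + m * (γ₁ + γ₂)) ^ 2) / m ^ 4)))) := by
  -- Any `m₀` serves, since `α` vanishes in every dimension; `h0` contradicts the hypothesis `α p ≠
  -- 0` in the last two clauses.
  refine ⟨0, fun m hm c P _ _ _ S hS hric M _ _ _ ψ hψ N A hN hA hPH hbi α β hgrad => ?_⟩
  have h0 := grad_normH_eq_zero (n := 2 * m + 1) (k := 2 * m) rfl (by omega) hS hric hψ hN hA
    hPH.1 hbi hgrad
  refine ⟨fun _ _ => exists_eq_const_of_mfderiv_eq_zero (fun p => (hgrad p).1) fun p v => ?_,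
    fun _ _ ⟨p, hp⟩ => hp (h0 p).1, fun p _ _ _ _ _ hα => absurd (h0 p).1 hα⟩
  refine ((hgrad p).2 v).trans ?_
  simp only [(h0 p).1, (h0 p).2, zero_smul, add_zero, map_zero, _root_.zero_apply]
  rfl
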